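/- Let $f_1,f_2:\mathbb{R}^2\to\mathbb{R}^2$ be $C^1$ and let $D$ be the set of all solutions $x:\mathbb{R}\to\mathbb{R}^2$ of the differential inclusion $\dot x\in\{f_1(x),f_2(x)\}$, that is, of all functions $x$ that are absolutely continuous on every compact interval and satisfy $\dot x(t)\in\{f_1(x(t)),f_2(x(t))\}$ for almost every $t\in\mathbb{R}$ (switching between the branches is unrestricted). A simple path from $a$ to $b$ in a set $V\subseteq\mathbb{R}^2$ generated by $D$ is given by a solution $v\in D$ and times $t_0<t_1$ with $v(t_0)=a$, $v(t_1)=b$, $v([t_0,t_1])\subseteq V$, $v(t)\neq a$ and $v(t)\ne b$ for all $t_0<t<t_1$, and such that $\dot v$ has only finitely many discontinuities on $[t_0,t_1]$ (i.e. $\dot v$ exists and is continuous on $[t_0,t_1]$ outside a finite set). Let $K\subset\mathbb{R}^2$ be a compact set in which $f_2$ has no bounded solutions, i.e. no solution $y:\mathbb{R}\to\mathbb{R}^2$ of $\dot y=f_2(y)$ satisfies $y(t)\in K$ for all $t\in\mathbb{R}$. Let $a^*\in K$ be a hyperbolic fixed point of $f_1$ (a sink, a source or a saddle): $f_1(a^*)=0$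 and no eigenvalue of $Df_1(a^*)$ has zero real part. Then every neighbourhood $U$ of $a^*$ contains a non-empty compact set $V$ (in particular, $V$ can be chosen inside $K$ when $a^*$ is an interior point of $K$) such that $\mathbb{R}^2\setminus V$ is connected and unbounded, and such that: (RS1) for all $a,b\in V$ (including $a=b$) there is a simple path from $a$ to $b$ in $V$ generated by $D$; (BV3) all concatenations of simple paths in $V$ are generated by $D$: for every finite or infinite sequence of points $a_1,a_2,\dots$, times $t_1<t_2<\cdots$ and solutions $v_1,v_2,\dots\in D$ such that $v_i$ on $[t_i,t_{i+1}]$ gives a simple path from $a_i$ to $a_{i+1}$ in $V$ for each $i$, there is a single solution $\gamma\in D$ with $\gamma(t)=v_i(t)$ for all $t\in[t_i,t_{i+1}]$ and all $i$. -/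

import Mathlib

open Set Filter Topology MeasureTheory

/-- The plane `ℝ²` with its Euclidean norm. -/
abbrev Plane : Type := EuclideanSpace ℝ (Fin 2)

/-- `x` is a solution, defined on all of `ℝ`, of the differential inclusion
`x' ∈ {f₁ x, f₂ x}`: it is absolutely continuous on every compact interval and satisfies the
inclusion at almost every time. -/
def IsInclusionSolution (f₁ f₂ : Plane → Plane) (x : ℝ → Plane) : Prop :=
  (∀ s t : ℝ, AbsolutelyContinuousOnInterval x s t) ∧
    ∀ᵐ t : ℝ, HasDerivAt x (f₁ (x t)) t ∨ HasDerivAt x (f₂ (x t)) t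

/-- The set of all solutions of `x' ∈ {f₁ x, f₂ x}`; switching between the two branches is
not restricted. -/
def solutionSet (f₁ f₂ : Plane → Plane) : Set (ℝ → Plane) :=
  {x | IsInclusionSolution f₁ f₂ x}

/-- The solution `v`, between the times `t₀ < t₁`, is a path from `a` to `b` generated by `D`. -/
structure IsPath (D : Set (ℝ → Plane)) (v : ℝ → Plane) (t₀ t₁ : ℝ) (a b : Plane) : Prop where
  mem : v ∈ D
  lt : t₀ < t₁
  source : v t₀ = a
  target : v t₁ = b

/-- The derivative of `v` exists and is continuous on `[t₀, t₁]` outside a finite set. -/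
def FinitelyManyDerivDiscontinuities (v : ℝ → Plane) (t₀ t₁ : ℝ) : Prop :=
  ∃ S : Set ℝ, S.Finite ∧
    ∀ t ∈ Icc t₀ t₁ \ S, DifferentiableAt ℝ v t ∧ ContinuousAt (deriv v) t

/-- A simple path from `a` to `b` generated by `D`: the velocity has finitely many
discontinuities, and `a`, `b` are not visited strictly between the end times
(the case `a = b` is allowed). -/
structure IsSimplePath (D : Set (ℝ → Plane)) (v : ℝ → Plane) (t₀ t₁ : ℝ) (a b : Plane) : Prop
    extends IsPath D v t₀ t₁ a b where
  finite_discontinuities : FinitelyManyDerivDiscontinuities v t₀ t₁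
  ne_endpoints : ∀ t ∈ Ioo t₀ t₁, v t ≠ a ∧ v t ≠ b

/-- A simple path generated by `D` that runs in the set `V`. -/
def IsSimplePathIn (D : Set (ℝ → Plane)) (V : Set Plane) (v : ℝ → Plane) (t₀ t₁ : ℝ)
    (a b : Plane) : Prop :=
  IsSimplePath D v t₀ t₁ a b ∧ ∀ t ∈ Icc t₀ t₁, v t ∈ V

/-- (RS1): any two points of `V`, equal or not, are joined by a simple path in `V`
generated by `D`. -/
def RS1 (D : Set (ℝ → Plane)) (V : Set Plane) : Prop :=
  ∀ a ∈ V, ∀ b ∈ V, ∃ (v : ℝ → Plane) (t₀ t₁ : ℝ), IsSimplePathIn D V v t₀ t₁ a b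

/-- The first `N` (possibly `N = ∞`) of the paths `v i` on `[t i, t (i + 1)]`, `i = 0, 1, …`,
have a concatenation generated by `D`: a single member of `D` follows `v i` on
`[t i, t (i + 1)]` for every `i < N`. -/
def HasConcatenation (D : Set (ℝ → Plane)) (N : ℕ∞) (v : ℕ → ℝ → Plane) (t : ℕ → ℝ) : Prop :=
  ∃ γ ∈ D, ∀ i : ℕ, (i : ℕ∞) < N → ∀ s ∈ Icc (t i) (t (i + 1)), γ s = v i s

/-- (BV3): every finite or infinite sequence of consecutive simple paths in `V` generated
by `D` has a concatenation generated by `D`. -/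
def BV3 (D : Set (ℝ → Plane)) (V : Set Plane) : Prop :=
  ∀ (N : ℕ∞) (a : ℕ → Plane) (t : ℕ → ℝ) (v : ℕ → ℝ → Plane), 1 ≤ N →
    (∀ i : ℕ, (i : ℕ∞) < N → IsSimplePathIn D V (v i) (t i) (t (i + 1)) (a i) (a (i + 1))) →
      HasConcatenation D N v t

/-- `a` is a hyperbolic fixed point of `x' = f x`: `f a = 0` and no complex eigenvalue of the
derivative of `f` at `a` is purely imaginary or zero. In the plane this means that `a` is a
sink, a source or a saddle. -/
def IsHyperbolicFixedPoint (f : Plane → Plane) (a : Plane) : Prop :=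
  f a = 0 ∧ ∀ z : ℂ,
    Polynomial.aeval z (LinearMap.charpoly (fderiv ℝ f a : Plane →ₗ[ℝ] Plane)) = 0 → z.re ≠ 0

/-- The differential equation `x' = f x` has no bounded solutions in `K`: no solution stays in
`K` for all times. -/
def NoBoundedSolutionsIn (f : Plane → Plane) (K : Set Plane) : Prop :=
  ¬ ∃ y : ℝ → Plane, ∀ t : ℝ, HasDerivAt y (f (y t)) t ∧ y t ∈ K

/-! The set `V` is the closed region between an orbit arc of `f₁` and an orbit arc of `f₂` that
share both end points and are run through in opposite directions. Since `f₂ a ≠ 0` (otherwise the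
constant `a` would be a bounded solution in `K`), there are linear coordinates with `L (f₂ a) = (1,
0)`. Hyperbolicity makes the derivative of `f₁` at `a` invertible, so the first coordinate of `f₁`
together with the determinant of `(f₁, f₂)` is a local diffeomorphism at `a`. Hence arbitrarily
close to `a` there is a point `q` where the branches are antiparallel and near which the determinant
takes both signs (`exists_opposite_branches`).

Near `q`, rescaling to unit first coordinate turns orbits of both branches into graphs. From a
common starting point the height difference of the two graphs initially has the sign of the
determinant there. For a small fixed width `τ` it is therefore positive for one starting point and
negative for another, and by the intermediate value theorem it vanishes for some third one: the two
graphs meet again (`exists_regionBetweenGraphs`).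

On the region `f₁` points left and `f₂` points right, so the boundary is a closed loop of the
inclusion. The `f₂`-orbit of any point of the region reaches the boundary forwards and backwards
without leaving the region, so all points reach each other (`reaches_of_regionBetweenGraphs`).

Mutual reachability in a nontrivial `V` with bounded velocities gives (RS1) by trimming arcs, and
with compactness (BV3): closed arcs repeated periodically supply pasts and futures for all time, and
Lipschitz curves in a compact set have limits at accumulation times. -/

open scoped NNReal

/-! ### Velocity bounds and Lipschitz curves -/

/-- A continuous curve whose velocity is bounded by `M` off a countable set moves by at most `M`
times the elapsed time. -/
theorem norm_sub_le_of_norm_deriv_le_off_countable {v : ℝ → Plane} {s t M : ℝ} (hst : s ≤ t)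
    {S : Set ℝ} (hS : S.Countable) (hc : ContinuousOn v (Icc s t))
    (hd : ∀ u ∈ Ioo s t \ S, DifferentiableAt ℝ v u ∧ ‖deriv v u‖ ≤ M) :
    ‖v t - v s‖ ≤ M * (t - s) := by
  have hae : ∀ᵐ u, u ∈ Ioc s t → ‖deriv v u‖ ≤ M := by
    have h0 : ∀ᵐ u : ℝ, u ∉ S ∪ {t} :=
      ((hS.union (countable_singleton t)).measure_zero volume : _) |> measure_eq_zero_iff_ae_notMem.1
    filter_upwards [h0] with u hu hut
    simp only [mem_union, mem_singleton_iff, not_or] at hu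
    exact (hd u ⟨⟨hut.1, lt_of_le_of_ne hut.2 hu.2⟩, hu.1⟩).2
  have hint : IntervalIntegrable (deriv v) volume s t := by
    rw [intervalIntegrable_iff_integrableOn_Ioc_of_le hst]
    refine Integrable.mono' (g := fun _ => M) (integrable_const M)
      (stronglyMeasurable_deriv v).aestronglyMeasurable ?_
    rwa [ae_restrict_iff' measurableSet_Ioc]
  rw [← integral_eq_of_hasDerivAt_off_countable_of_le v (deriv v) hst hS hc
    (fun u hu => (hd u hu).1.hasDerivAt) hint]
  have := intervalIntegral.norm_integral_le_of_norm_le_const_ae (a := s) (b := t) (f := deriv v)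
    (C := M) (by rwa [uIoc_of_le hst])
  rwa [abs_of_nonneg (sub_nonneg.2 hst)] at this

theorem lipschitzOnWith_of_norm_deriv_le_off_countable {v : ℝ → Plane} {I S : Set ℝ} {M : ℝ≥0}
    (hI : I.OrdConnected) (hS : S.Countable) (hc : ContinuousOn v I)
    (hd : ∀ u ∈ I \ S, DifferentiableAt ℝ v u ∧ ‖deriv v u‖ ≤ M) : LipschitzOnWith M v I := by
  refine LipschitzOnWith.of_dist_le_mul fun p hp q hq => ?_
  wlog hpq : p ≤ q generalizing p q
  · rw [dist_comm, dist_comm p]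
    exact this q hq p hp (le_of_not_ge hpq)
  have hsub : Icc p q ⊆ I := hI.out hp hq
  rw [dist_comm, dist_eq_norm, dist_comm, Real.dist_eq, abs_of_nonneg (sub_nonneg.2 hpq)]
  exact norm_sub_le_of_norm_deriv_le_off_countable hpq hS (hc.mono hsub)
    fun u hu => hd u ⟨hsub (Ioo_subset_Icc_self hu.1), hu.2⟩

/-! ### Lipschitz solutions of the inclusion and their gluing -/

/-- `x` follows one of the two branches at time `t`. -/
def FollowsBranch (f₁ f₂ : Plane → Plane) (x : ℝ → Plane) (t : ℝ) : Prop :=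
  HasDerivAt x (f₁ (x t)) t ∨ HasDerivAt x (f₂ (x t)) t

theorem FollowsBranch.congr {f₁ f₂ : Plane → Plane} {x y : ℝ → Plane} {t : ℝ}
    (h : FollowsBranch f₁ f₂ x t) (hxy : y =ᶠ[𝓝 t] x) : FollowsBranch f₁ f₂ y t := by
  rw [FollowsBranch, hxy.eq_of_nhds]
  exact h.imp (fun h => h.congr_of_eventuallyEq hxy) (fun h => h.congr_of_eventuallyEq hxy)

theorem FollowsBranch.norm_deriv_le {f₁ f₂ : Plane → Plane} {x : ℝ → Plane} {t M : ℝ}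
    {V : Set Plane} (hM : ∀ z ∈ V, ‖f₁ z‖ ≤ M ∧ ‖f₂ z‖ ≤ M) (hx : x t ∈ V)
    (h : FollowsBranch f₁ f₂ x t) : DifferentiableAt ℝ x t ∧ ‖deriv x t‖ ≤ M := by
  rcases h with h | h
  · exact ⟨h.differentiableAt, h.deriv ▸ (hM _ hx).1⟩
  · exact ⟨h.differentiableAt, h.deriv ▸ (hM _ hx).2⟩

/-- On the time set `I`, the curve `x` is an `M`-Lipschitz solution of the inclusion in `V`. -/
structure IsLipschitzSolutionOn (f₁ f₂ : Plane → Plane) (V : Set Plane) (M : ℝ≥0)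
    (x : ℝ → Plane) (I : Set ℝ) : Prop where
  lipschitz : LipschitzOnWith M x I
  mapsTo : MapsTo x I V
  ae_follows : ∀ᵐ t, t ∈ I → FollowsBranch f₁ f₂ x t

namespace IsLipschitzSolutionOn

variable {f₁ f₂ : Plane → Plane} {V : Set Plane} {M : ℝ≥0} {x y : ℝ → Plane} {I : Set ℝ}

theorem mono {J : Set ℝ} (h : IsLipschitzSolutionOn f₁ f₂ V M x I) (hJ : J ⊆ I) :
    IsLipschitzSolutionOn f₁ f₂ V M x J :=
  ⟨h.lipschitz.mono hJ, h.mapsTo.mono_left hJ, h.ae_follows.mono fun _ ht hJt => ht (hJ hJt)⟩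

theorem mem_solutionSet (h : IsLipschitzSolutionOn f₁ f₂ V M x univ) : x ∈ solutionSet f₁ f₂ :=
  ⟨fun _ _ => (h.lipschitz.mono (subset_univ _)).absolutelyContinuousOnInterval,
    h.ae_follows.mono fun _ ht => ht (mem_univ _)⟩

/-- Countably many exceptional times are allowed, not just finitely many, because a periodic
extension repeats the switching times of one period infinitely often. -/
theorem of_off_countable {S : Set ℝ} (hM : ∀ z ∈ V, ‖f₁ z‖ ≤ M ∧ ‖f₂ z‖ ≤ M)
    (hI : I.OrdConnected) (hS : S.Countable) (hc : ContinuousOn x I) (hV : MapsTo x I V)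
    (hf : ∀ u ∈ I \ S, FollowsBranch f₁ f₂ x u) : IsLipschitzSolutionOn f₁ f₂ V M x I := by
  refine ⟨lipschitzOnWith_of_norm_deriv_le_off_countable hI hS hc
    fun u hu => (hf u hu).norm_deriv_le hM (hV hu.1), hV, ?_⟩
  filter_upwards [measure_eq_zero_iff_ae_notMem.1 (hS.measure_zero volume)] with u hu huI
  exact hf u ⟨huI, hu⟩

theorem glue {c : ℝ} (hc : c ∈ I) (hx : IsLipschitzSolutionOn f₁ f₂ V M x (I ∩ Iic c))
    (hy : IsLipschitzSolutionOn f₁ f₂ V M y (I ∩ Ici c)) (hxy : x c = y c) :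
    IsLipschitzSolutionOn f₁ f₂ V M (fun t => if t ≤ c then x t else y t) I := by
  refine ⟨LipschitzOnWith.of_dist_le_mul fun p hp q hq => ?_, fun t ht => ?_, ?_⟩
  · wlog hpq : p ≤ q generalizing p q
    · rw [dist_comm, dist_comm p]
      exact this q hq p hp (le_of_not_ge hpq)
    by_cases hqc : q ≤ c
    · simp only [hpq.trans hqc, hqc, if_true]
      exact hx.lipschitz.dist_le_mul p ⟨hp, hpq.trans hqc⟩ q ⟨hq, hqc⟩
    · by_cases hpc : p ≤ c
      · simp only [hpc, hqc, if_true, if_false]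
        have h1 := hx.lipschitz.dist_le_mul p ⟨hp, hpc⟩ c ⟨hc, self_mem_Iic⟩
        have h2 := hy.lipschitz.dist_le_mul c ⟨hc, self_mem_Ici⟩ q ⟨hq, (not_le.1 hqc).le⟩
        have h3 : dist p q = dist p c + dist c q := by
          rw [Real.dist_eq, Real.dist_eq, Real.dist_eq, abs_of_nonpos (by linarith),
            abs_of_nonpos (by linarith), abs_of_nonpos (by linarith [not_le.1 hqc])]
          ring
        calc dist (x p) (y q) ≤ dist (x p) (x c) + dist (y c) (y q) := by
              rw [← hxy]; exact dist_triangle _ _ _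
          _ ≤ M * dist p q := by rw [h3, mul_add]; exact add_le_add h1 h2
      · simp only [hpc, hqc, if_false]
        exact hy.lipschitz.dist_le_mul p ⟨hp, (not_le.1 hpc).le⟩ q ⟨hq, (not_le.1 hqc).le⟩
  · by_cases htc : t ≤ c
    · simpa only [htc, if_true] using hx.mapsTo ⟨ht, htc⟩
    · simpa only [htc, if_false] using hy.mapsTo ⟨ht, (not_le.1 htc).le⟩
  · have h0 : ∀ᵐ t : ℝ, t ≠ c := by simp [ae_iff, measure_singleton]
    filter_upwards [h0, hx.ae_follows, hy.ae_follows] with t htc h1 h2 ht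
    rcases lt_or_gt_of_ne htc with h | h
    · refine (h1 ⟨ht, h.le⟩).congr ?_
      filter_upwards [Iio_mem_nhds h] with r hr
      rw [if_pos (le_of_lt hr)]
    · refine (h2 ⟨ht, h.le⟩).congr ?_
      filter_upwards [Ioi_mem_nhds h] with r hr
      rw [if_neg (not_le.2 hr)]

/-- A Lipschitz solution between two times extends by Lipschitz solutions to all times. -/
theorem extend {z : ℝ → Plane} {s t : ℝ} (hst : s ≤ t)
    (hx : IsLipschitzSolutionOn f₁ f₂ V M x (Iic s))
    (hy : IsLipschitzSolutionOn f₁ f₂ V M y (Icc s t))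
    (hz : IsLipschitzSolutionOn f₁ f₂ V M z (Ici t)) (hxy : x s = y s) (hyz : y t = z t) :
    ∃ w, IsLipschitzSolutionOn f₁ f₂ V M w univ ∧ EqOn w x (Iic s) ∧ EqOn w y (Icc s t) := by
  have h1 : IsLipschitzSolutionOn f₁ f₂ V M (fun r => if r ≤ s then x r else y r) (Iic t) :=
    glue hst (hx.mono inter_subset_right)
      (hy.mono fun r hr => ⟨hr.2, hr.1⟩) hxy
  have h2 := glue (I := univ) (c := t) (mem_univ t) (h1.mono inter_subset_right)
    (hz.mono inter_subset_right) (by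
      by_cases h : t ≤ s
      · obtain rfl := le_antisymm hst h
        simpa [hxy] using hyz
      · simpa [h] using hyz)
  refine ⟨_, h2, fun r (hr : r ≤ s) => ?_, fun r hr => ?_⟩
  · simp [hr.trans hst, hr]
  · by_cases h : r ≤ s
    · obtain rfl := le_antisymm h hr.1
      simp [hst, hxy]
    · simp [hr.2, h]

end IsLipschitzSolutionOn

/-! ### Arcs with finitely many switches -/

/-- On `[s, t]` the curve `v` runs in `V` and switches finitely often between the branches. -/
structure IsSwitchingArc (f₁ f₂ : Plane → Plane) (V : Set Plane) (v : ℝ → Plane) (s t : ℝ) :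
    Prop where
  continuousOn : ContinuousOn v (Icc s t)
  mapsTo : MapsTo v (Icc s t) V
  follows : ∃ S : Set ℝ, S.Finite ∧ ∀ u ∈ Ioo s t \ S,
    (∀ᶠ r in 𝓝 u, HasDerivAt v (f₁ (v r)) r) ∨ ∀ᶠ r in 𝓝 u, HasDerivAt v (f₂ (v r)) r

namespace IsSwitchingArc

variable {f₁ f₂ : Plane → Plane} {V : Set Plane} {v w : ℝ → Plane} {s t r : ℝ}

theorem follows_congr {f : Plane → Plane} {u : ℝ}
    (h : ∀ᶠ r in 𝓝 u, HasDerivAt v (f (v r)) r) (hvw : w =ᶠ[𝓝 u] v) :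
    ∀ᶠ r in 𝓝 u, HasDerivAt w (f (w r)) r := by
  filter_upwards [h, hvw.eventuallyEq_nhds] with r hr hr'
  rw [hr'.eq_of_nhds]
  exact hr.congr_of_eventuallyEq hr'

theorem mono (h : IsSwitchingArc f₁ f₂ V v s t) {s' t' : ℝ} (hs : s ≤ s') (ht : t' ≤ t) :
    IsSwitchingArc f₁ f₂ V v s' t' := by
  obtain ⟨S, hS, hf⟩ := h.follows
  exact ⟨h.continuousOn.mono (Icc_subset_Icc hs ht), h.mapsTo.mono_left (Icc_subset_Icc hs ht),
    S, hS, fun u hu => hf u ⟨Ioo_subset_Ioo hs ht hu.1, hu.2⟩⟩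

theorem shift (h : IsSwitchingArc f₁ f₂ V v s t) (c : ℝ) :
    IsSwitchingArc f₁ f₂ V (fun r => v (r - c)) (s + c) (t + c) := by
  obtain ⟨S, hS, hf⟩ := h.follows
  have hmaps : MapsTo (fun r => r - c) (Icc (s + c) (t + c)) (Icc s t) :=
    fun r hr => ⟨by linarith [hr.1], by linarith [hr.2]⟩
  refine ⟨h.continuousOn.comp (by fun_prop) hmaps, h.mapsTo.comp hmaps, (fun r => r + c) '' S,
    hS.image _, fun u hu => ?_⟩
  have hu' : u - c ∈ Ioo s t \ S :=
    ⟨⟨by linarith [hu.1.1], by linarith [hu.1.2]⟩, fun hS => hu.2 ⟨u - c, hS, by simp⟩⟩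
  have ht : Tendsto (fun r : ℝ => r - c) (𝓝 u) (𝓝 (u - c)) :=
    (continuous_id.sub continuous_const).tendsto u
  exact (hf _ hu').imp (fun h => (ht.eventually h).mono fun r hr => hr.comp_sub_const r c)
    (fun h => (ht.eventually h).mono fun r hr => hr.comp_sub_const r c)

theorem glue (hst : s ≤ t) (htr : t ≤ r) (hv : IsSwitchingArc f₁ f₂ V v s t)
    (hw : IsSwitchingArc f₁ f₂ V w t r) (hvw : v t = w t) :
    IsSwitchingArc f₁ f₂ V (fun u => if u ≤ t then v u else w u) s r := by
  obtain ⟨S, hS, hf⟩ := hv.follows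
  obtain ⟨S', hS', hf'⟩ := hw.follows
  have e1 : EqOn (fun u => if u ≤ t then v u else w u) v (Icc s t) := fun u hu => by
    simp [hu.2]
  have e2 : EqOn (fun u => if u ≤ t then v u else w u) w (Icc t r) := fun u hu => by
    by_cases h : u ≤ t
    · obtain rfl := le_antisymm h hu.1
      simpa using hvw
    · simp [h]
  refine ⟨?_, ?_, S ∪ S' ∪ {t}, (hS.union hS').union (finite_singleton t), fun u hu => ?_⟩
  · rw [← Icc_union_Icc_eq_Icc hst htr]
    exact (hv.continuousOn.congr e1).union_of_isClosed (hw.continuousOn.congr e2)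
      isClosed_Icc isClosed_Icc
  · rw [← Icc_union_Icc_eq_Icc hst htr]
    exact (hv.mapsTo.congr e1.symm).union (hw.mapsTo.congr e2.symm)
  · obtain ⟨⟨hu1, hu2⟩, hu3⟩ := hu
    simp only [mem_union, mem_singleton_iff, not_or] at hu3
    rcases lt_or_gt_of_ne hu3.2 with h | h
    · have : (fun u => if u ≤ t then v u else w u) =ᶠ[𝓝 u] v := by
        filter_upwards [Iio_mem_nhds h] with q hq
        simp [(mem_Iio.1 hq).le]
      exact (hf u ⟨⟨hu1, h⟩, hu3.1.1⟩).imp (follows_congr · this) (follows_congr · this)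
    · have : (fun u => if u ≤ t then v u else w u) =ᶠ[𝓝 u] w := by
        filter_upwards [Ioi_mem_nhds h] with q hq
        simp [not_le.2 (mem_Ioi.1 hq)]
      exact (hf' u ⟨⟨h, hu2⟩, hu3.1.2⟩).imp (follows_congr · this) (follows_congr · this)

theorem isLipschitzSolutionOn {M : ℝ≥0} (hM : ∀ z ∈ V, ‖f₁ z‖ ≤ M ∧ ‖f₂ z‖ ≤ M)
    (h : IsSwitchingArc f₁ f₂ V v s t) : IsLipschitzSolutionOn f₁ f₂ V M v (Icc s t) := by
  obtain ⟨S, hS, hf⟩ := h.follows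
  refine .of_off_countable (S := S ∪ {s, t}) hM ordConnected_Icc
    (hS.union ((finite_singleton t).insert s)).countable h.continuousOn h.mapsTo fun u hu => ?_
  obtain ⟨hu1, hu2⟩ := hu
  simp only [mem_union, mem_insert_iff, mem_singleton_iff, not_or] at hu2
  exact (hf u ⟨⟨lt_of_le_of_ne hu1.1 (Ne.symm hu2.2.1), lt_of_le_of_ne hu1.2 hu2.2.2⟩, hu2.1⟩).imp
    (fun h => h.self_of_nhds) (fun h => h.self_of_nhds)

/-- A closed arc extends periodically to a solution on the whole time axis. -/
theorem exists_periodic {M : ℝ≥0} (hM : ∀ z ∈ V, ‖f₁ z‖ ≤ M ∧ ‖f₂ z‖ ≤ M) (hst : s < t)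
    (h : IsSwitchingArc f₁ f₂ V v s t) (hv : v s = v t) :
    ∃ x, IsLipschitzSolutionOn f₁ f₂ V M x univ ∧ x s = v s := by
  obtain ⟨T, hT, rfl⟩ : ∃ T, 0 < T ∧ t = s + T := ⟨t - s, by linarith, by ring⟩
  have : Fact (0 < T) := ⟨hT⟩
  obtain ⟨S, hS, hf⟩ := h.follows
  -- Factoring through the circle `ℝ / T` gives continuity at the junctions from `v s = v (s + T)`;
  -- away from translates of `S ∪ {s}` the curve is locally a time shift of `v`.
  set x : ℝ → Plane := fun r => AddCircle.liftIco T s v (r : AddCircle T) with hx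
  have hper : ∀ (n : ℤ) (r : ℝ), r - n • T ∈ Ico s (s + T) → x r = v (r - n • T) := by
    intro n r hr
    rw [← AddCircle.liftIco_coe_apply (B := Plane) (f := v) hr, hx]
    simp [AddCircle.coe_period]
  have hex : ∀ r : ℝ, ∃ n : ℤ, r - n • T ∈ Ico s (s + T) := fun r =>
    (existsUnique_sub_zsmul_mem_Ico hT r s).exists
  refine ⟨x, .of_off_countable (S := ⋃ n : ℤ, (fun r => r + n • T) '' (S ∪ {s})) hM
    ordConnected_univ (countable_iUnion fun n => (hS.union (finite_singleton s)).countable.image _)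
    ?_ ?_ ?_, ?_⟩
  · exact ((AddCircle.liftIco_continuous hv h.continuousOn).comp
      (AddCircle.continuous_mk' T)).continuousOn
  · intro r _
    obtain ⟨n, hn⟩ := hex r
    rw [hper n r hn]
    exact h.mapsTo ⟨hn.1, hn.2.le⟩
  · rintro r ⟨-, hr⟩
    obtain ⟨n, hn⟩ := hex r
    have hr' : r - n • T ∉ S ∪ {s} := fun h' => hr (mem_iUnion.2 ⟨n, r - n • T, h', by simp⟩)
    simp only [mem_union, mem_singleton_iff, not_or] at hr'
    have hmem : r - n • T ∈ Ioo s (s + T) := ⟨lt_of_le_of_ne hn.1 (Ne.symm hr'.2), hn.2⟩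
    have hev : x =ᶠ[𝓝 r] fun q => v (q - n • T) := by
      have : Tendsto (fun q : ℝ => q - n • T) (𝓝 r) (𝓝 (r - n • T)) :=
        (continuous_id.sub continuous_const).tendsto r
      filter_upwards [this.eventually (isOpen_Ioo.mem_nhds hmem)] with q hq
      exact hper n q ⟨hq.1.le, hq.2⟩
    refine FollowsBranch.congr ?_ hev
    exact (hf _ ⟨hmem, hr'.1⟩).imp (fun h => h.self_of_nhds.comp_sub_const r _)
      (fun h => h.self_of_nhds.comp_sub_const r _)
  · simpa using hper 0 s (by simp [hT])

end IsSwitchingArc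

/-! ### Reachability -/

/-- `b` is reached from `a` along a finitely switching arc in `V`. -/
def Reaches (f₁ f₂ : Plane → Plane) (V : Set Plane) (a b : Plane) : Prop :=
  ∃ (v : ℝ → Plane) (s t : ℝ), s ≤ t ∧ IsSwitchingArc f₁ f₂ V v s t ∧ v s = a ∧ v t = b

/-- Concatenation of arcs, starting at a prescribed time and remembering the point of contact. -/
theorem Reaches.exists_arc_through {f₁ f₂ : Plane → Plane} {V : Set Plane} {a b c : Plane}
    (hab : Reaches f₁ f₂ V a b) (hbc : Reaches f₁ f₂ V b c) (s : ℝ) :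
    ∃ (v : ℝ → Plane) (t r : ℝ), s ≤ t ∧ t ≤ r ∧ IsSwitchingArc f₁ f₂ V v s r ∧
      v s = a ∧ v t = b ∧ v r = c := by
  obtain ⟨v, p, q, hpq, hv, hvp, hvq⟩ := hab
  obtain ⟨w, p', q', hpq', hw, hwp, hwq⟩ := hbc
  have hv' := hv.shift (s - p)
  have hw' := hw.shift (s - p + q - p')
  rw [show p + (s - p) = s by ring] at hv'
  rw [show p' + (s - p + q - p') = q + (s - p) by ring] at hw'
  refine ⟨_, q + (s - p), q' + (s - p + q - p'), by linarith, by linarith,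
    hv'.glue (by linarith) (by linarith) hw' ?_, ?_, ?_, ?_⟩
  · simp only [add_sub_cancel_right]
    rw [hvq, ← hwp]
    congr 1
    ring
  · rw [if_pos (by linarith), ← hvp]
    congr 1
    ring
  · simp [hvq]
  · split_ifs with h
    · have : q' = p' := by linarith
      subst this
      rw [← hwq, hwp, ← hvq]
      congr 1
      ring
    · simp [hwq]

theorem Reaches.trans {f₁ f₂ : Plane → Plane} {V : Set Plane} {a b c : Plane}
    (hab : Reaches f₁ f₂ V a b) (hbc : Reaches f₁ f₂ V b c) : Reaches f₁ f₂ V a c := by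
  obtain ⟨v, t, r, hst, htr, hv, h1, -, h3⟩ := hab.exists_arc_through hbc 0
  exact ⟨v, 0, r, hst.trans htr, hv, h1, h3⟩

/-! ### Limits and unions of Lipschitz solutions -/

namespace IsLipschitzSolutionOn

variable {f₁ f₂ : Plane → Plane} {V : Set Plane} {M : ℝ≥0} {x : ℝ → Plane}

/-- A Lipschitz solution in a compact set up to a finite time has a limit at that time. -/
theorem exists_extend_Iic {T : ℝ} (hV : IsCompact V)
    (hx : IsLipschitzSolutionOn f₁ f₂ V M x (Iio T)) :
    ∃ y, IsLipschitzSolutionOn f₁ f₂ V M y (Iic T) ∧ EqOn y x (Iio T) := by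
  obtain ⟨u, -, huT, hu⟩ := exists_seq_strictMono_tendsto T
  obtain ⟨c, hc, φ, hφ, hlim⟩ := hV.tendsto_subseq (x := fun n => x (u n))
    fun n => hx.mapsTo (huT n)
  -- The Lipschitz bound upgrades the subsequential limit `c` to the limit of the whole curve.
  have hdist : ∀ r < T, dist (x r) c ≤ M * dist r T := fun r hr =>
    le_of_tendsto_of_tendsto' (tendsto_const_nhds.dist hlim)
      ((tendsto_const_nhds.dist (hu.comp hφ.tendsto_atTop)).const_mul _)
      fun n => hx.lipschitz.dist_le_mul r hr _ (huT _)
  have heq : EqOn (Function.update x T c) x (Iio T) := fun r hr =>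
    Function.update_of_ne (ne_of_lt hr) _ _
  refine ⟨Function.update x T c, ⟨LipschitzOnWith.of_dist_le_mul fun p hp q hq => ?_, ?_, ?_⟩, heq⟩
  · rcases (mem_Iic.1 hp).eq_or_lt with rfl | hp' <;> rcases (mem_Iic.1 hq).eq_or_lt with rfl | hq'
    · simp
    · rw [Function.update_self, heq hq', dist_comm, dist_comm p]
      exact hdist q hq'
    · rw [Function.update_self, heq hp']
      exact hdist p hp'
    · rw [heq hp', heq hq']
      exact hx.lipschitz.dist_le_mul p hp' q hq'
  · intro r hr
    rcases (mem_Iic.1 hr).eq_or_lt with rfl | hr'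
    · simpa using hc
    · rw [heq hr']
      exact hx.mapsTo hr'
  · have h0 : ∀ᵐ t : ℝ, t ≠ T := by simp [ae_iff, measure_singleton]
    filter_upwards [h0, hx.ae_follows] with r hrT h hr
    have hr' : r < T := lt_of_le_of_ne hr hrT
    exact (h hr').congr (heq.eventuallyEq_of_mem (Iio_mem_nhds hr'))

/-- Coherent solutions on an increasing sequence of half-lines have a common extension. -/
theorem exists_iUnion {γ : ℕ → ℝ → Plane} {t : ℕ → ℝ}
    (hγ : ∀ n, IsLipschitzSolutionOn f₁ f₂ V M (γ n) (Iic (t n)))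
    (hcoh : ∀ n m, n ≤ m → EqOn (γ n) (γ m) (Iic (t n))) :
    ∃ x, IsLipschitzSolutionOn f₁ f₂ V M x (⋃ n, Iio (t n)) ∧
      ∀ n, EqOn x (γ n) (Iio (t n)) := by
  -- An index is needed for every `r`; outside the union the value `0` is arbitrary.
  have hex : ∀ r : ℝ, ∃ n, r ∈ (⋃ n, Iio (t n)) → r < t n := fun r => by
    by_cases h : r ∈ ⋃ n, Iio (t n)
    · obtain ⟨n, hn⟩ := mem_iUnion.1 h
      exact ⟨n, fun _ => hn⟩
    · exact ⟨0, fun h' => absurd h' h⟩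
  choose idx hidx using hex
  have heq : ∀ n, EqOn (fun r => γ (idx r) r) (γ n) (Iio (t n)) := fun n r hr => by
    have hr' := hidx r (mem_iUnion.2 ⟨n, hr⟩)
    rcases le_total n (idx r) with h | h
    · exact (hcoh _ _ h (mem_Iio.1 hr).le).symm
    · exact hcoh _ _ h hr'.le
  refine ⟨fun r => γ (idx r) r, ⟨LipschitzOnWith.of_dist_le_mul fun p hp q hq => ?_,
    fun r hr => (hγ _).mapsTo (hidx r hr).le, ?_⟩, heq⟩
  · wlog hpq : p ≤ q generalizing p q
    · rw [dist_comm, dist_comm p]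
      exact this q hq p hp (le_of_not_ge hpq)
    have hq' := hidx q hq
    have h1 := heq (idx q) (hpq.trans_lt hq')
    have h2 := heq (idx q) hq'
    simp only at h1 h2 ⊢
    rw [h1]
    exact (hγ (idx q)).lipschitz.dist_le_mul p (hpq.trans hq'.le) q hq'.le
  · filter_upwards [ae_all_iff.2 fun n => (hγ n).ae_follows] with r h hr
    have hr' := hidx r hr
    exact (h (idx r) hr'.le).congr ((heq (idx r)).eventuallyEq_of_mem (Iio_mem_nhds hr'))

end IsLipschitzSolutionOn

/-! ### From reachability to (RS1) and (BV3) -/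

theorem exists_last_hit {v : ℝ → Plane} {s t : ℝ} {a : Plane} (hv : ContinuousOn v (Icc s t))
    (hst : s ≤ t) (ha : v s = a) :
    ∃ r ∈ Icc s t, v r = a ∧ ∀ u ∈ Ioc r t, v u ≠ a := by
  have hK : IsCompact (Icc s t ∩ v ⁻¹' {a}) :=
    isCompact_Icc.of_isClosed_subset
      (hv.preimage_isClosed_of_isClosed isClosed_Icc isClosed_singleton) inter_subset_left
  obtain ⟨r, ⟨hr, hra⟩, hmax⟩ := hK.exists_isGreatest ⟨s, ⟨le_rfl, hst⟩, ha⟩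
  exact ⟨r, hr, hra, fun u hu hua =>
    not_le.2 hu.1 (hmax ⟨⟨hr.1.trans hu.1.le, hu.2⟩, hua⟩)⟩

theorem exists_first_hit {v : ℝ → Plane} {s t : ℝ} {b : Plane} (hv : ContinuousOn v (Icc s t))
    (hst : s ≤ t) (hb : v t = b) :
    ∃ r ∈ Icc s t, v r = b ∧ ∀ u ∈ Ico s r, v u ≠ b := by
  have hK : IsCompact (Icc s t ∩ v ⁻¹' {b}) :=
    isCompact_Icc.of_isClosed_subset
      (hv.preimage_isClosed_of_isClosed isClosed_Icc isClosed_singleton) inter_subset_left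
  obtain ⟨r, ⟨hr, hrb⟩, hmin⟩ := hK.exists_isLeast ⟨t, ⟨hst, le_rfl⟩, hb⟩
  exact ⟨r, hr, hrb, fun u hu hub =>
    not_le.2 hu.2 (hmin ⟨⟨hu.1, hu.2.le.trans hr.2⟩, hub⟩)⟩

section Reachable

variable {f₁ f₂ : Plane → Plane} {V : Set Plane} {M : ℝ≥0}

/-- In a set with more than one point in which all points reach each other, arcs can be shortened
to avoid their end points at intermediate times. -/
theorem exists_simple_switchingArc (hV : V.Nontrivial)
    (hreach : ∀ a ∈ V, ∀ b ∈ V, Reaches f₁ f₂ V a b) {a b : Plane} (ha : a ∈ V) (hb : b ∈ V) :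
    ∃ (v : ℝ → Plane) (s t : ℝ), s < t ∧ IsSwitchingArc f₁ f₂ V v s t ∧ v s = a ∧ v t = b ∧
      ∀ r ∈ Ioo s t, v r ≠ a ∧ v r ≠ b := by
  by_cases hab : a = b
  · subst hab
    -- A loop at `a` makes a detour through some `c ≠ a`; it is cut to the piece from the last visit
    -- of `a` before `c` to the first visit after it.
    obtain ⟨c, hc, hca⟩ := hV.exists_ne a
    obtain ⟨v, t, r, hst, htr, hv, h1, h2, h3⟩ :=
      (hreach a ha c hc).exists_arc_through (hreach c hc a ha) 0
    obtain ⟨s', hs', hs'a, hs'n⟩ :=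
      exists_last_hit (hv.continuousOn.mono (Icc_subset_Icc_right htr)) hst h1
    obtain ⟨r', hr', hr'a, hr'n⟩ :=
      exists_first_hit (hv.continuousOn.mono (Icc_subset_Icc_left hst)) htr h3
    have hs't : s' < t := lt_of_le_of_ne hs'.2 fun h => hca (by rw [← h2, ← h, hs'a])
    have key : ∀ u ∈ Ioo s' r', v u ≠ a := fun u hu => by
      rcases le_total u t with h | h
      · exact hs'n u ⟨hu.1, h⟩
      · exact hr'n u ⟨h, hu.2⟩
    exact ⟨v, s', r', hs't.trans_le hr'.1, hv.mono hs'.1 hr'.2, hs'a, hr'a,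
      fun u hu => ⟨key u hu, key u hu⟩⟩
  · obtain ⟨v, s, t, hst, hv, h1, h2⟩ := hreach a ha b hb
    -- Cut at the first visit of `b`, and only then at the last preceding visit of `a`, so that the
    -- second cut cannot spoil the first.
    obtain ⟨t', ht', ht'b, ht'n⟩ := exists_first_hit hv.continuousOn hst h2
    obtain ⟨s', hs', hs'a, hs'n⟩ :=
      exists_last_hit (hv.continuousOn.mono (Icc_subset_Icc_right ht'.2)) ht'.1 h1
    exact ⟨v, s', t', lt_of_le_of_ne hs'.2 fun h => hab (by rw [← hs'a, ← ht'b, h]),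
      hv.mono hs'.1 ht'.2, hs'a, ht'b,
      fun u hu => ⟨hs'n u ⟨hu.1, hu.2.le⟩, ht'n u ⟨hs'.1.trans hu.1.le, hu.2⟩⟩⟩

/-- Members of `D` live on all of `ℝ`, whereas orbits of a single branch may leave `V` or blow up. A
loop at `a` repeated periodically provides a past and a future inside `V` for anything that ends or
starts at `a`. -/
theorem exists_solution_through (hM : ∀ z ∈ V, ‖f₁ z‖ ≤ M ∧ ‖f₂ z‖ ≤ M) (hV : V.Nontrivial)
    (hreach : ∀ a ∈ V, ∀ b ∈ V, Reaches f₁ f₂ V a b) {a : Plane} (ha : a ∈ V) (s : ℝ) :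
    ∃ x, IsLipschitzSolutionOn f₁ f₂ V M x univ ∧ x s = a := by
  obtain ⟨v, p, q, hpq, hv, h1, h2, -⟩ := exists_simple_switchingArc hV hreach ha ha
  obtain ⟨x, hx, hxp⟩ := (hv.shift (s - p)).exists_periodic hM (by linarith) (by simp [h1, h2])
  exact ⟨x, hx, by simpa [h1] using hxp⟩

theorem rs1_of_reaches (hf₁ : Continuous f₁) (hf₂ : Continuous f₂)
    (hM : ∀ z ∈ V, ‖f₁ z‖ ≤ M ∧ ‖f₂ z‖ ≤ M) (hV : V.Nontrivial)
    (hreach : ∀ a ∈ V, ∀ b ∈ V, Reaches f₁ f₂ V a b) : RS1 (solutionSet f₁ f₂) V := by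
  intro a ha b hb
  obtain ⟨v, s, t, hst, hv, hs, ht, hne⟩ := exists_simple_switchingArc hV hreach ha hb
  obtain ⟨x, hx, hxs⟩ := exists_solution_through hM hV hreach ha s
  obtain ⟨z, hz, hzt⟩ := exists_solution_through hM hV hreach hb t
  obtain ⟨w, hw, -, hwv⟩ := (hx.mono (subset_univ _)).extend hst.le (hv.isLipschitzSolutionOn hM)
    (hz.mono (subset_univ _)) (hxs.trans hs.symm) (ht.trans hzt.symm)
  obtain ⟨S, hS, hf⟩ := hv.follows
  refine ⟨w, s, t, ⟨⟨hw.mem_solutionSet, hst, (hwv ⟨le_rfl, hst.le⟩).trans hs,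
    (hwv ⟨hst.le, le_rfl⟩).trans ht⟩, ⟨S ∪ {s, t}, hS.union ((finite_singleton t).insert s), ?_⟩,
    fun r hr => ?_⟩, fun r _ => hw.mapsTo (mem_univ r)⟩
  · intro u hu
    obtain ⟨hu1, hu2⟩ := hu
    simp only [mem_union, mem_insert_iff, mem_singleton_iff, not_or] at hu2
    have hu' : u ∈ Ioo s t :=
      ⟨lt_of_le_of_ne hu1.1 (Ne.symm hu2.2.1), lt_of_le_of_ne hu1.2 hu2.2.2⟩
    have hev : w =ᶠ[𝓝 u] v := by
      filter_upwards [isOpen_Ioo.mem_nhds hu'] with r hr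
      exact hwv (Ioo_subset_Icc_self hr)
    have key : ∀ f : Plane → Plane, Continuous f → (∀ᶠ r in 𝓝 u, HasDerivAt v (f (v r)) r) →
        DifferentiableAt ℝ w u ∧ ContinuousAt (deriv w) u := by
      intro f hf h
      have h' := IsSwitchingArc.follows_congr h hev
      have hd : DifferentiableAt ℝ w u := h'.self_of_nhds.differentiableAt
      have he : deriv w =ᶠ[𝓝 u] fun r => f (w r) := h'.mono fun r hr => hr.deriv
      exact ⟨hd, (hf.continuousAt.comp hd.continuousAt).congr he.symm⟩
    exact (hf u ⟨hu', hu2.1⟩).elim (key f₁ hf₁) (key f₂ hf₂)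
  · rw [hwv (Ioo_subset_Icc_self hr)]
    exact hne r hr

/-- The inclusion bounds the velocity only at almost every time. At a continuity point of the
derivative the bound follows by density, which leaves finitely many exceptional times. -/
theorem IsSimplePathIn.isLipschitzSolutionOn (hM : ∀ z ∈ V, ‖f₁ z‖ ≤ M ∧ ‖f₂ z‖ ≤ M)
    {v : ℝ → Plane} {s t : ℝ} {a b : Plane}
    (h : IsSimplePathIn (solutionSet f₁ f₂) V v s t a b) :
    IsLipschitzSolutionOn f₁ f₂ V M v (Icc s t) := by
  obtain ⟨h, hV⟩ := h
  have hae : ∀ᵐ r, FollowsBranch f₁ f₂ v r := h.mem.2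
  obtain ⟨S, hS, hd⟩ := h.finite_discontinuities
  have hc : ContinuousOn v (Icc s t) := by
    have := (h.mem.1 s t).continuousOn
    rwa [uIcc_of_le h.lt.le] at this
  refine ⟨lipschitzOnWith_of_norm_deriv_le_off_countable (S := S ∪ {s, t}) ordConnected_Icc
    (hS.union ((finite_singleton t).insert s)).countable hc ?_, hV, hae.mono fun r hr _ => hr⟩
  intro u hu
  obtain ⟨hu1, hu2⟩ := hu
  simp only [mem_union, mem_insert_iff, mem_singleton_iff, not_or] at hu2
  have hu' : u ∈ Ioo s t :=
    ⟨lt_of_le_of_ne hu1.1 (Ne.symm hu2.2.1), lt_of_le_of_ne hu1.2 hu2.2.2⟩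
  obtain ⟨hdu, hcu⟩ := hd u ⟨hu1, hu2.1⟩
  refine ⟨hdu, le_of_not_gt fun hlt => ?_⟩
  -- A velocity above `M` at `u` would persist on an open set of times, which must contain a time
  -- where the inclusion holds.
  have hev : ∀ᶠ r in 𝓝 u, r ∈ Ioo s t ∧ (M : ℝ) < ‖deriv v r‖ :=
    Filter.Eventually.and (Ioo_mem_nhds hu'.1 hu'.2) (hcu.norm.eventually (lt_mem_nhds hlt))
  obtain ⟨O, hO, hOo, huO⟩ := eventually_nhds_iff.1 hev
  obtain ⟨r, hrO, hr⟩ := (Measure.dense_of_ae hae).inter_open_nonempty O hOo ⟨u, huO⟩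
  exact not_le.2 (hO r hrO).2 (FollowsBranch.norm_deriv_le hM
    (hV r (Ioo_subset_Icc_self (hO r hrO).1)) hr).2

/-- Finite prefixes are extended one path at a time. An infinite sequence is the union of these
extensions; if its times accumulate, the limit point lies in `V` and a periodic solution continues
from there. -/
theorem bv3_of_reaches (hVc : IsCompact V)
    (hM : ∀ z ∈ V, ‖f₁ z‖ ≤ M ∧ ‖f₂ z‖ ≤ M) (hV : V.Nontrivial)
    (hreach : ∀ a ∈ V, ∀ b ∈ V, Reaches f₁ f₂ V a b) : BV3 (solutionSet f₁ f₂) V := by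
  intro N a t v hN hpath
  have hlt : ∀ i : ℕ, (i : ℕ∞) < N → t i < t (i + 1) := fun i hi => (hpath i hi).1.lt
  have hcast : ∀ i n : ℕ, i ≤ n → (n : ℕ∞) < N → (i : ℕ∞) < N := fun i n hin hn =>
    lt_of_le_of_lt (Nat.cast_le.2 hin) hn
  have hmono : ∀ n : ℕ, (n : ℕ∞) < N → ∀ i ≤ n, t (i + 1) ≤ t (n + 1) := by
    intro n
    induction n with
    | zero => rintro - i hi; rw [Nat.le_zero.1 hi]
    | succ n ih =>
      intro hn i hi
      rcases Nat.le_succ_iff.1 hi with h | rfl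
      · exact (ih (hcast _ _ n.le_succ hn) i h).trans (hlt _ hn).le
      · exact le_rfl
  have hcover : ∀ (n : ℕ) (r : ℝ), t 0 ≤ r → r ≤ t (n + 1) →
      ∃ i ≤ n, r ∈ Icc (t i) (t (i + 1)) := by
    intro n
    induction n with
    | zero => exact fun r h1 h2 => ⟨0, le_rfl, h1, h2⟩
    | succ n ih =>
      intro r h1 h2
      rcases le_total r (t (n + 1)) with h | h
      · obtain ⟨i, hi, hr⟩ := ih r h1 h
        exact ⟨i, hi.trans n.le_succ, hr⟩
      · exact ⟨n + 1, le_rfl, h, h2⟩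
  have h0 : ((0 : ℕ) : ℕ∞) < N := lt_of_lt_of_le (by simp) hN
  have hmem : ∀ i : ℕ, (i : ℕ∞) < N → v i (t (i + 1)) ∈ V := fun i hi =>
    (hpath i hi).2 _ ⟨(hlt i hi).le, le_rfl⟩
  obtain ⟨x₀, hx₀, hx₀t⟩ := exists_solution_through hM hV hreach
    ((hpath 0 h0).2 _ ⟨le_rfl, (hlt 0 h0).le⟩) (t 0)
  -- All prefixes share the past `x₀` before `t 0`; this makes the solutions chosen for different
  -- `n` coherent.
  have hstep : ∀ n : ℕ, (n : ℕ∞) < N → ∃ γ, IsLipschitzSolutionOn f₁ f₂ V M γ univ ∧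
      EqOn γ x₀ (Iic (t 0)) ∧ ∀ i ≤ n, EqOn γ (v i) (Icc (t i) (t (i + 1))) := by
    intro n
    induction n with
    | zero =>
      intro hn
      obtain ⟨z, hz, hzt⟩ := exists_solution_through hM hV hreach (hmem 0 hn) (t (0 + 1))
      obtain ⟨w, hw, hw1, hw2⟩ := (hx₀.mono (subset_univ _)).extend (hlt 0 hn).le
        ((hpath 0 hn).isLipschitzSolutionOn hM) (hz.mono (subset_univ _)) hx₀t hzt.symm
      exact ⟨w, hw, hw1, fun i hi => by rw [Nat.le_zero.1 hi]; exact hw2⟩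
    | succ n ih =>
      intro hn
      have hn' := hcast _ _ n.le_succ hn
      obtain ⟨γ, hγ, hγ1, hγ2⟩ := ih hn'
      obtain ⟨z, hz, hzt⟩ := exists_solution_through hM hV hreach (hmem _ hn) (t (n + 1 + 1))
      obtain ⟨w, hw, hw1, hw2⟩ := (hγ.mono (subset_univ _)).extend (hlt _ hn).le
        ((hpath _ hn).isLipschitzSolutionOn hM) (hz.mono (subset_univ _))
        (by rw [hγ2 n le_rfl ⟨(hlt n hn').le, le_rfl⟩, (hpath n hn').1.target,
          (hpath _ hn).1.source]) hzt.symm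
      have ht0 : t 0 ≤ t (n + 1) := (hlt 0 h0).le.trans (hmono n hn' 0 n.zero_le)
      refine ⟨w, hw, fun r hr => ?_, fun i hi r hr => ?_⟩
      · rw [hw1 (le_trans hr ht0), hγ1 hr]
      · rcases Nat.le_succ_iff.1 hi with h | rfl
        · rw [hw1 (hr.2.trans (hmono n hn' i h)), hγ2 i h hr]
        · exact hw2 hr
  induction N using ENat.recTopCoe with
  | coe k =>
    obtain ⟨n, rfl⟩ : ∃ n, k = n + 1 := ⟨k - 1, by
      have : 0 < k := by exact_mod_cast h0
      omega⟩
    obtain ⟨γ, hγ, -, hγ2⟩ := hstep n (by exact_mod_cast n.lt_succ_self)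
    exact ⟨γ, hγ.mem_solutionSet, fun i hi => hγ2 i (by
      have : i < n + 1 := by exact_mod_cast hi
      omega)⟩
  | top =>
    have htop : ∀ n : ℕ, (n : ℕ∞) < ⊤ := fun n => ENat.natCast_lt_top n
    choose γ hγ hγ1 hγ2 using fun n : ℕ => hstep n (htop n)
    have htm : StrictMono t := strictMono_nat_of_lt_succ fun n => hlt n (htop n)
    have hcoh : ∀ n m, n ≤ m → EqOn (γ n) (γ m) (Iic (t (n + 1))) := by
      intro n m hnm r hr
      rcases le_total r (t 0) with h | h
      · rw [hγ1 n h, hγ1 m h]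
      · obtain ⟨i, hi, hri⟩ := hcover n r h hr
        rw [hγ2 n i hi hri, hγ2 m i (hi.trans hnm) hri]
    obtain ⟨x, hx, hxγ⟩ := IsLipschitzSolutionOn.exists_iUnion (t := fun n => t (n + 1))
      (fun n => (hγ n).mono (subset_univ _)) hcoh
    have hxv : ∀ i, EqOn x (v i) (Icc (t i) (t (i + 1))) := fun i r hr => by
      -- The index `i + 1` rather than `i` is needed since `hxγ i` omits the end time `t (i + 1)`.
      rw [hxγ (i + 1) (hr.2.trans_lt (htm (i + 1).lt_succ_self)), hγ2 (i + 1) i i.le_succ hr]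
    by_cases hbdd : BddAbove (range t)
    · have hIio : (⋃ n, Iio (t (n + 1))) = Iio (⨆ n, t n) := by
        ext r
        simp only [mem_iUnion, mem_Iio]
        refine ⟨fun ⟨n, hn⟩ => hn.trans_le (le_ciSup hbdd _), fun h => ?_⟩
        obtain ⟨n, hn⟩ := exists_lt_of_lt_ciSup h
        exact ⟨n, hn.trans (htm n.lt_succ_self)⟩
      rw [hIio] at hx
      obtain ⟨y, hy, hyx⟩ := hx.exists_extend_Iic hVc
      obtain ⟨z, hz, hzt⟩ := exists_solution_through hM hV hreach (hy.mapsTo self_mem_Iic) (⨆ n, t n)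
      -- The middle piece is the single time `⨆ n, t n`.
      obtain ⟨w, hw, hw1, -⟩ := hy.extend le_rfl (hy.mono fun r hr => hr.2)
        (hz.mono (subset_univ _)) rfl hzt.symm
      refine ⟨w, hw.mem_solutionSet, fun i _ r hr => ?_⟩
      have hr' : r < ⨆ n, t n :=
        (hr.2.trans_lt (htm (i + 1).lt_succ_self)).trans_le (le_ciSup hbdd _)
      rw [hw1 hr'.le, hyx hr', hxv i hr]
    · have huniv : (⋃ n, Iio (t (n + 1))) = univ := by
        refine eq_univ_of_forall fun r => mem_iUnion.2 ?_
        obtain ⟨-, ⟨n, rfl⟩, hn⟩ := not_bddAbove_iff.1 hbdd r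
        exact ⟨n, hn.trans (htm n.lt_succ_self)⟩
      rw [huniv] at hx
      exact ⟨x, hx.mem_solutionSet, fun i _ => hxv i⟩

end Reachable

/-! ### Change of time along a branch -/

/-- A change of time with prescribed positive speed. -/
theorem exists_time_change {k : ℝ → ℝ} {s t : ℝ} (hst : s ≤ t) (hk : ContinuousOn k (Icc s t))
    (hpos : ∀ r ∈ Icc s t, 0 < k r) :
    ∃ (σ : ℝ → ℝ) (T : ℝ), 0 ≤ T ∧ σ 0 = s ∧ σ T = t ∧ Continuous σ ∧ StrictMono σ ∧
      ∀ r ∈ Icc 0 T, HasDerivAt σ (k (σ r))⁻¹ r := by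
  obtain ⟨r₀, hr₀, hmin⟩ := isCompact_Icc.exists_isMinOn (nonempty_Icc.2 hst) hk
  set m := k r₀ with hm
  have hm0 : 0 < m := hpos r₀ hr₀
  -- `K` continues `k` constantly beyond `[s, t]` and so stays above `m > 0`. Its primitive `F` is
  -- then a bijection of `ℝ`, and the time change is the inverse of `F`.
  set K : ℝ → ℝ := IccExtend hst (Icc s t |>.domRestrict k) with hK
  have hKc : Continuous K := (continuousOn_iff_continuous_domRestrict.1 hk).Icc_extend'
  have hKm : ∀ r, m ≤ K r := fun r => hmin (projIcc s t hst r).2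
  have hKk : ∀ r ∈ Icc s t, K r = k r := fun r hr => by
    rw [hK, IccExtend_of_mem hst _ hr]; rfl
  set F : ℝ → ℝ := fun r => ∫ q in s..r, K q with hF
  have hFd : ∀ r, HasDerivAt F (K r) r := fun r => hKc.integral_hasStrictDerivAt s r |>.hasDerivAt
  have hFs : F s = 0 := intervalIntegral.integral_same
  have hFm : StrictMono F := strictMono_of_deriv_pos fun r => by
    rw [(hFd r).deriv]; exact hm0.trans_le (hKm r)
  have hG : Monotone fun r => F r - m * (r - s) := by
    have hd : ∀ r, HasDerivAt (fun r => F r - m * (r - s)) (K r - m * 1) r := fun r =>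
      (hFd r).sub (((hasDerivAt_id r).sub_const s).const_mul m)
    exact monotone_of_deriv_nonneg (fun r => (hd r).differentiableAt) fun r => by
      rw [(hd r).deriv]; linarith [hKm r]
  have hsurj : Function.Surjective F := by
    have hFc : Continuous F := continuous_iff_continuousAt.2 fun r => (hFd r).continuousAt
    refine hFc.surjective ?_ ?_
    · refine tendsto_atTop_mono' _ ?_
        ((tendsto_id.const_mul_atTop hm0).atTop_add (tendsto_const_nhds (x := -(m * s))))
      filter_upwards [eventually_ge_atTop s] with r hr
      have := hG hr
      simp only [hFs, sub_self, mul_zero, id] at this ⊢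
      linarith
    · refine tendsto_atBot_mono' _ ?_
        ((tendsto_id.const_mul_atBot hm0).atBot_add (tendsto_const_nhds (x := -(m * s))))
      filter_upwards [eventually_le_atBot s] with r hr
      have := hG hr
      simp only [hFs, sub_self, mul_zero, id] at this ⊢
      linarith
  set e := hFm.orderIsoOfSurjective F hsurj with he
  have heF : ∀ r, e r = F r := fun r => rfl
  have hσc : Continuous e.symm := e.symm.continuous
  have hs : e.symm 0 = s := by rw [← hFs, ← heF]; exact e.symm_apply_apply s
  have ht : e.symm (F t) = t := e.symm_apply_apply t
  refine ⟨e.symm, F t, hFs ▸ hFm.monotone hst, hs, ht, hσc, e.symm.strictMono, fun r hr => ?_⟩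
  have hmem : e.symm r ∈ Icc s t :=
    ⟨hs ▸ e.symm.monotone hr.1, (e.symm.monotone hr.2).trans_eq ht⟩
  rw [← hKk _ hmem]
  exact HasDerivAt.of_local_left_inverse hσc.continuousAt (hFd _)
    (hm0.trans_le (hKm _)).ne' (Eventually.of_forall fun y => e.apply_symm_apply y)

section Reparametrization

variable {f₁ f₂ f : Plane → Plane} {V : Set Plane} {u : ℝ → Plane} {k : ℝ → ℝ} {s t : ℝ}

/-- A curve with velocity a positive multiple of a branch is traversed by a solution. -/
theorem Reaches.of_pos_multiple (hf : f = f₁ ∨ f = f₂) (hst : s ≤ t)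
    (hk : ContinuousOn k (Icc s t)) (hpos : ∀ r ∈ Icc s t, 0 < k r)
    (hu : ContinuousOn u (Icc s t)) (hV : MapsTo u (Icc s t) V)
    (hd : ∀ r ∈ Ioo s t, HasDerivAt u (k r • f (u r)) r) : Reaches f₁ f₂ V (u s) (u t) := by
  obtain ⟨σ, T, hT, h0, h1, hσc, hσm, hσd⟩ := exists_time_change hst hk hpos
  have hIcc : MapsTo σ (Icc 0 T) (Icc s t) := fun r hr =>
    ⟨h0 ▸ hσm.monotone hr.1, h1 ▸ hσm.monotone hr.2⟩
  have hIoo : MapsTo σ (Ioo 0 T) (Ioo s t) := fun r hr => ⟨h0 ▸ hσm hr.1, h1 ▸ hσm hr.2⟩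
  have key : ∀ r ∈ Ioo 0 T, HasDerivAt (u ∘ σ) (f ((u ∘ σ) r)) r := fun r hr => by
    have h := (hd _ (hIoo hr)).scomp r (hσd r (Ioo_subset_Icc_self hr))
    rwa [smul_smul, inv_mul_cancel₀ (hpos _ (hIcc (Ioo_subset_Icc_self hr))).ne', one_smul] at h
  refine ⟨u ∘ σ, 0, T, hT, ⟨hu.comp hσc.continuousOn hIcc, hV.comp hIcc, ∅, finite_empty,
    fun r hr => ?_⟩, congrArg u h0, congrArg u h1⟩
  have hev : ∀ᶠ q in 𝓝 r, HasDerivAt (u ∘ σ) (f ((u ∘ σ) q)) q := by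
    filter_upwards [isOpen_Ioo.mem_nhds hr.1] with q hq
    exact key q hq
  rcases hf with rfl | rfl
  · exact Or.inl hev
  · exact Or.inr hev

/-- A curve with velocity a negative multiple of a branch is traversed backwards by a solution. -/
theorem Reaches.of_neg_multiple (hf : f = f₁ ∨ f = f₂) (hst : s ≤ t)
    (hk : ContinuousOn k (Icc s t)) (hneg : ∀ r ∈ Icc s t, k r < 0)
    (hu : ContinuousOn u (Icc s t)) (hV : MapsTo u (Icc s t) V)
    (hd : ∀ r ∈ Ioo s t, HasDerivAt u (k r • f (u r)) r) : Reaches f₁ f₂ V (u t) (u s) := by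
  have hm : MapsTo (fun r : ℝ => -r) (Icc (-t) (-s)) (Icc s t) := fun r hr =>
    ⟨by linarith [hr.2], by linarith [hr.1]⟩
  have h := Reaches.of_pos_multiple (f₁ := f₁) (f₂ := f₂) (V := V) (u := fun r => u (-r))
    (k := fun r => -k (-r)) hf (neg_le_neg hst)
    (hk.comp continuous_neg.continuousOn hm).neg (fun r hr => neg_pos.2 (hneg _ (hm hr)))
    (hu.comp continuous_neg.continuousOn hm) (hV.comp hm) fun r hr => by
      have := (hd (-r) ⟨by linarith [hr.2], by linarith [hr.1]⟩).scomp r (hasDerivAt_neg r)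
      simpa [neg_smul, Function.comp_def] using this
  simpa using h

end Reparametrization

/-! ### Boundary hits and the region between two graphs -/

theorem exists_first_zero {h : ℝ → ℝ} {s t : ℝ} (hh : ContinuousOn h (Icc s t)) (hst : s ≤ t)
    (h0 : h s ≤ 0) (h1 : 0 ≤ h t) : ∃ r ∈ Icc s t, h r = 0 ∧ ∀ x ∈ Icc s r, h x ≤ 0 := by
  have hK : IsCompact (Icc s t ∩ h ⁻¹' {0}) :=
    isCompact_Icc.of_isClosed_subset
      (hh.preimage_isClosed_of_isClosed isClosed_Icc isClosed_singleton) inter_subset_left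
  obtain ⟨r₀, hr₀, hr₀0⟩ := intermediate_value_Icc hst hh ⟨h0, h1⟩
  obtain ⟨r, ⟨hr, hr0⟩, hmin⟩ := hK.exists_isLeast ⟨r₀, hr₀, hr₀0⟩
  refine ⟨r, hr, hr0, fun x hx => le_of_not_gt fun hpos => ?_⟩
  -- A positive value before `r` would force a zero before `r`.
  obtain ⟨q, hq, hq0⟩ := intermediate_value_Icc hx.1
    (hh.mono (Icc_subset_Icc_right (hx.2.trans hr.2))) ⟨h0, hpos.le⟩
  have hrq : r ≤ q := hmin ⟨⟨hq.1, hq.2.trans (hx.2.trans hr.2)⟩, hq0⟩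
  have hxr : x = r := le_antisymm hx.2 (hrq.trans hq.2)
  rw [hxr, hr0] at hpos
  exact lt_irrefl _ hpos

theorem exists_last_zero {h : ℝ → ℝ} {s t : ℝ} (hh : ContinuousOn h (Icc s t)) (hst : s ≤ t)
    (h0 : 0 ≤ h s) (h1 : h t ≤ 0) : ∃ r ∈ Icc s t, h r = 0 ∧ ∀ x ∈ Icc r t, h x ≤ 0 := by
  have hm : MapsTo (fun r : ℝ => -r) (Icc (-t) (-s)) (Icc s t) := fun r hr =>
    ⟨by linarith [hr.2], by linarith [hr.1]⟩
  obtain ⟨r, hr, hr0, hle⟩ := exists_first_zero (h := fun r => h (-r))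
    (hh.comp continuous_neg.continuousOn hm) (neg_le_neg hst) (by simpa using h1)
    (by simpa using h0)
  exact ⟨-r, hm hr, hr0, fun x hx => by
    simpa using hle (-x) ⟨by linarith [hx.2], by linarith [hx.1]⟩⟩

/-- The points over `[α, β]` between the graphs of `y₁` and `y₂`. -/
def regionBetweenGraphs (α β : ℝ) (y₁ y₂ : ℝ → ℝ) : Set (ℝ × ℝ) :=
  {q | q.1 ∈ Icc α β ∧ (q.2 - y₁ q.1) * (q.2 - y₂ q.1) ≤ 0}

section Region

variable {α β : ℝ} {y₁ y₂ : ℝ → ℝ}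

theorem exists_bound_on_Icc (h₁ : Continuous y₁) (h₂ : Continuous y₂) :
    ∃ B, ∀ x ∈ Icc α β, |y₁ x| ≤ B ∧ |y₂ x| ≤ B := by
  obtain ⟨B₁, hB₁⟩ := isCompact_Icc.exists_bound_of_continuousOn (s := Icc α β) h₁.continuousOn
  obtain ⟨B₂, hB₂⟩ := isCompact_Icc.exists_bound_of_continuousOn (s := Icc α β) h₂.continuousOn
  exact ⟨max B₁ B₂, fun x hx =>
    ⟨(hB₁ x hx).trans (le_max_left _ _), (hB₂ x hx).trans (le_max_right _ _)⟩⟩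

theorem isCompact_regionBetweenGraphs (h₁ : Continuous y₁) (h₂ : Continuous y₂) :
    IsCompact (regionBetweenGraphs α β y₁ y₂) := by
  obtain ⟨B, hB⟩ := exists_bound_on_Icc (α := α) (β := β) h₁ h₂
  refine (isCompact_Icc.prod (isCompact_Icc (a := -B) (b := B))).of_isClosed_subset
    (s := Icc α β ×ˢ Icc (-B) B) ?_ ?_
  · have hc : Continuous fun q : ℝ × ℝ => (q.2 - y₁ q.1) * (q.2 - y₂ q.1) := by fun_prop
    exact (isClosed_Icc.preimage continuous_fst).inter (isClosed_le hc continuous_const)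
  · rintro ⟨x, y⟩ ⟨hx, hy⟩
    obtain ⟨hb1, hb2⟩ := hB x hx
    rw [abs_le] at hb1 hb2
    refine ⟨hx, le_of_not_gt fun h => not_lt.2 hy ?_, le_of_not_gt fun h => not_lt.2 hy ?_⟩
    · exact mul_pos_of_neg_of_neg (by simp only at h ⊢; linarith) (by simp only at h ⊢; linarith)
    · exact mul_pos (by simp only at h ⊢; linarith) (by simp only at h ⊢; linarith)

/-- Every point outside is joined to a base point at height `B + 1`, above both graphs. Points below
both graphs go down, then left past `α`, then up. -/
theorem isPathConnected_compl_regionBetweenGraphs (h₁ : Continuous y₁) (h₂ : Continuous y₂) :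
    IsPathConnected (regionBetweenGraphs α β y₁ y₂)ᶜ := by
  obtain ⟨B, hB⟩ := exists_bound_on_Icc (α := α) (β := β) h₁ h₂
  have hcompl : ∀ q : ℝ × ℝ, q ∈ (regionBetweenGraphs α β y₁ y₂)ᶜ ↔
      (q.1 ∈ Icc α β → 0 < (q.2 - y₁ q.1) * (q.2 - y₂ q.1)) := fun q => by
    simp [regionBetweenGraphs]
  have hup : ∀ q : ℝ × ℝ, q.2 = B + 1 → q ∈ (regionBetweenGraphs α β y₁ y₂)ᶜ := fun q hq =>
    (hcompl q).2 fun hx => by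
      obtain ⟨hb1, hb2⟩ := hB _ hx
      rw [abs_le] at hb1 hb2
      exact mul_pos (by linarith) (by linarith)
  have hdown : ∀ q : ℝ × ℝ, q.2 = -(B + 1) → q ∈ (regionBetweenGraphs α β y₁ y₂)ᶜ := fun q hq =>
    (hcompl q).2 fun hx => by
      obtain ⟨hb1, hb2⟩ := hB _ hx
      rw [abs_le] at hb1 hb2
      exact mul_pos_of_neg_of_neg (by linarith) (by linarith)
  have hvert : ∀ x y y' : ℝ, (∀ z ∈ uIcc y y', (x, z) ∈ (regionBetweenGraphs α β y₁ y₂)ᶜ) →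
      JoinedIn (regionBetweenGraphs α β y₁ y₂)ᶜ (x, y) (x, y') := fun x y y' h =>
    JoinedIn.of_segment_subset fun q hq => by
      have := Prod.segment_subset _ _ hq
      simp only [segment_same, segment_eq_uIcc, mem_prod, mem_singleton_iff] at this
      have e : q = (x, q.2) := Prod.ext this.1 rfl
      rw [e]
      exact h _ this.2
  have hhor : ∀ x x' y : ℝ, (∀ q : ℝ × ℝ, q.2 = y → q ∈ (regionBetweenGraphs α β y₁ y₂)ᶜ) →
      JoinedIn (regionBetweenGraphs α β y₁ y₂)ᶜ (x, y) (x', y) := fun x x' y h =>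
    JoinedIn.of_segment_subset fun q hq => by
      have := Prod.segment_subset _ _ hq
      simp only [segment_same, mem_prod, mem_singleton_iff] at this
      exact h q this.2
  have hout : ∀ x, x ∉ Icc α β → ∀ z, (x, z) ∈ (regionBetweenGraphs α β y₁ y₂)ᶜ :=
    fun x hx z => (hcompl _).2 fun h => absurd h hx
  refine ⟨(α - 1, B + 1), hup _ rfl, ?_⟩
  rintro ⟨x, y⟩ hq
  refine JoinedIn.symm ?_
  by_cases hx : x ∈ Icc α β
  · obtain ⟨hb1, hb2⟩ := hB x hx
    rw [abs_le] at hb1 hb2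
    rcases mul_pos_iff.1 ((hcompl _).1 hq hx) with ⟨p1, p2⟩ | ⟨p1, p2⟩
    · simp only at p1 p2
      refine (hvert x y (B + 1) fun z hz => (hcompl _).2 fun _ => ?_).trans (hhor _ _ _ hup)
      rcases le_total y (B + 1) with h | h
      · rw [uIcc_of_le h] at hz
        exact mul_pos (by simp only; linarith [hz.1]) (by simp only; linarith [hz.1])
      · rw [uIcc_of_ge h] at hz
        exact mul_pos (by simp only; linarith [hz.1]) (by simp only; linarith [hz.1])
    · simp only at p1 p2
      refine ((hvert x y (-(B + 1)) fun z hz => (hcompl _).2 fun _ => ?_).trans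
        (hhor _ (α - 1) _ hdown)).trans (hvert _ _ _ fun z _ => hout _ (by simp) z)
      rcases le_total y (-(B + 1)) with h | h
      · rw [uIcc_of_le h] at hz
        exact mul_pos_of_neg_of_neg (by simp only; linarith [hz.2]) (by simp only; linarith [hz.2])
      · rw [uIcc_of_ge h] at hz
        exact mul_pos_of_neg_of_neg (by simp only; linarith [hz.2]) (by simp only; linarith [hz.2])
  · exact (hvert x y (B + 1) fun z _ => hout x hx z).trans (hhor _ _ _ hup)

end Region

/-! ### Mutual reachability in the region -/

section Transit

variable {f₁ f₂ : Plane → Plane} {L : Plane ≃L[ℝ] ℝ × ℝ} {α β : ℝ} {y₁ y₂ : ℝ → ℝ}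

/-- If the graph of `y₁` is run through leftwards by the first branch, the graph of `y₂` is run
through rightwards by the second one, and the second branch leads from every point of the region
between the graphs to its boundary, in both directions of time, then all points of the region reach
each other. -/
theorem reaches_of_regionBetweenGraphs (hf₁ : Continuous f₁) (hf₂ : Continuous f₂) (hαβ : α ≤ β)
    (h₁ : Continuous y₁) (h₂ : Continuous y₂) (hα : y₁ α = y₂ α) (hβ : y₁ β = y₂ β)
    (hneg : ∀ z ∈ L ⁻¹' regionBetweenGraphs α β y₁ y₂, (L (f₁ z)).1 < 0)
    (hpos : ∀ z ∈ L ⁻¹' regionBetweenGraphs α β y₁ y₂, 0 < (L (f₂ z)).1)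
    (hd₁ : ∀ x ∈ Ioo α β, HasDerivAt (fun x => L.symm (x, y₁ x))
      ((L (f₁ (L.symm (x, y₁ x)))).1⁻¹ • f₁ (L.symm (x, y₁ x))) x)
    (hd₂ : ∀ x ∈ Ioo α β, HasDerivAt (fun x => L.symm (x, y₂ x))
      ((L (f₂ (L.symm (x, y₂ x)))).1⁻¹ • f₂ (L.symm (x, y₂ x))) x)
    (hw : ∀ p ∈ L ⁻¹' regionBetweenGraphs α β y₁ y₂, ∃ w : ℝ → Plane, w (L p).1 = p ∧
      ∀ x ∈ Icc α β, (L (w x)).1 = x ∧ HasDerivAt w ((L (f₂ (w x))).1⁻¹ • f₂ (w x)) x) :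
    ∀ a ∈ L ⁻¹' regionBetweenGraphs α β y₁ y₂, ∀ b ∈ L ⁻¹' regionBetweenGraphs α β y₁ y₂,
      Reaches f₁ f₂ (L ⁻¹' regionBetweenGraphs α β y₁ y₂) a b := by
  set V := L ⁻¹' regionBetweenGraphs α β y₁ y₂ with hVdef
  have hV₁ : ∀ x ∈ Icc α β, L.symm (x, y₁ x) ∈ V := fun x hx => by
    simp [hVdef, regionBetweenGraphs, hx.1, hx.2]
  have hV₂ : ∀ x ∈ Icc α β, L.symm (x, y₂ x) ∈ V := fun x hx => by
    simp [hVdef, regionBetweenGraphs, hx.1, hx.2]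
  have hkc : ∀ (f : Plane → Plane) (u : ℝ → Plane) (s t : ℝ), Continuous f →
      ContinuousOn u (Icc s t) → (∀ x ∈ Icc s t, (L (f (u x))).1 ≠ 0) →
      ContinuousOn (fun x => (L (f (u x))).1⁻¹) (Icc s t) := fun f u s t hf hu hne =>
    ContinuousOn.inv₀ ((continuous_fst.comp (L.continuous.comp hf)).comp_continuousOn hu) hne
  have hR₁ : ∀ s t, α ≤ s → s ≤ t → t ≤ β →
      Reaches f₁ f₂ V (L.symm (t, y₁ t)) (L.symm (s, y₁ s)) := fun s t hs hst ht => by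
    have hsub : Icc s t ⊆ Icc α β := Icc_subset_Icc hs ht
    have hu : ContinuousOn (fun x => L.symm (x, y₁ x)) (Icc s t) :=
      (L.symm.continuous.comp (continuous_id.prodMk h₁)).continuousOn
    exact Reaches.of_neg_multiple (Or.inl rfl) hst
      (hkc f₁ _ s t hf₁ hu fun x hx => (hneg _ (hV₁ x (hsub hx))).ne)
      (fun x hx => inv_lt_zero.2 (hneg _ (hV₁ x (hsub hx)))) hu
      (fun x hx => hV₁ x (hsub hx)) fun x hx => hd₁ x (Ioo_subset_Ioo hs ht hx)
  have hR₂ : ∀ s t, α ≤ s → s ≤ t → t ≤ β →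
      Reaches f₁ f₂ V (L.symm (s, y₂ s)) (L.symm (t, y₂ t)) := fun s t hs hst ht => by
    have hsub : Icc s t ⊆ Icc α β := Icc_subset_Icc hs ht
    have hu : ContinuousOn (fun x => L.symm (x, y₂ x)) (Icc s t) :=
      (L.symm.continuous.comp (continuous_id.prodMk h₂)).continuousOn
    exact Reaches.of_pos_multiple (Or.inr rfl) hst
      (hkc f₂ _ s t hf₂ hu fun x hx => (hpos _ (hV₂ x (hsub hx))).ne')
      (fun x hx => inv_pos.2 (hpos _ (hV₂ x (hsub hx)))) hu
      (fun x hx => hV₂ x (hsub hx)) fun x hx => hd₂ x (Ioo_subset_Ioo hs ht hx)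
  -- The boundary loop: everything is routed through the left corner, leftwards along `y₁` and
  -- rightwards along `y₂`, with the turn at the right corner.
  have hto₁ : ∀ x ∈ Icc α β, Reaches f₁ f₂ V (L.symm (x, y₁ x)) (L.symm (α, y₁ α)) :=
    fun x hx => hR₁ α x le_rfl hx.1 hx.2
  have hto₂ : ∀ x ∈ Icc α β, Reaches f₁ f₂ V (L.symm (x, y₂ x)) (L.symm (α, y₁ α)) :=
    fun x hx => (hR₂ x β hx.1 hx.2 le_rfl).trans (hβ ▸ hto₁ β ⟨hαβ, le_rfl⟩)
  have hfrom₂ : ∀ x ∈ Icc α β, Reaches f₁ f₂ V (L.symm (α, y₁ α)) (L.symm (x, y₂ x)) :=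
    fun x hx => hα ▸ hR₂ α x le_rfl hx.1 hx.2
  have hfrom₁ : ∀ x ∈ Icc α β, Reaches f₁ f₂ V (L.symm (α, y₁ α)) (L.symm (x, y₁ x)) :=
    fun x hx => (hfrom₂ β ⟨hαβ, le_rfl⟩).trans (hβ ▸ hR₁ x β hx.1 hx.2 le_rfl)
  have hbdry : ∀ z : Plane, ((L z).2 - y₁ (L z).1) * ((L z).2 - y₂ (L z).1) = 0 →
      z = L.symm ((L z).1, y₁ (L z).1) ∨ z = L.symm ((L z).1, y₂ (L z).1) := fun z hz => by
    rcases mul_eq_zero.1 hz with h | h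
    · left
      rw [← sub_eq_zero.1 h, Prod.mk.eta, L.symm_apply_apply]
    · right
      rw [← sub_eq_zero.1 h, Prod.mk.eta, L.symm_apply_apply]
  have hcurve : ∀ w : ℝ → Plane,
      (∀ x ∈ Icc α β, (L (w x)).1 = x ∧ HasDerivAt w ((L (f₂ (w x))).1⁻¹ • f₂ (w x)) x) →
      ∀ s t, α ≤ s → s ≤ t → t ≤ β →
      (∀ x ∈ Icc s t, ((L (w x)).2 - y₁ x) * ((L (w x)).2 - y₂ x) ≤ 0) →
      Reaches f₁ f₂ V (w s) (w t) := fun w hw s t hs hst ht hle => by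
    have hsub : Icc s t ⊆ Icc α β := Icc_subset_Icc hs ht
    have hu : ContinuousOn w (Icc s t) := fun x hx =>
      (hw x (hsub hx)).2.continuousAt.continuousWithinAt
    have hV : MapsTo w (Icc s t) V := fun x hx => by
      have h := (hw x (hsub hx)).1
      refine ⟨by rw [h]; exact hsub hx, ?_⟩
      rw [h]
      exact hle x hx
    exact Reaches.of_pos_multiple (Or.inr rfl) hst
      (hkc f₂ _ s t hf₂ hu fun x hx => (hpos _ (hV hx)).ne')
      (fun x hx => inv_pos.2 (hpos _ (hV hx))) hu hV
      fun x hx => (hw x (hsub (Ioo_subset_Icc_self hx))).2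
  have hcont : ∀ w : ℝ → Plane,
      (∀ x ∈ Icc α β, (L (w x)).1 = x ∧ HasDerivAt w ((L (f₂ (w x))).1⁻¹ • f₂ (w x)) x) →
      ContinuousOn (fun x => ((L (w x)).2 - y₁ x) * ((L (w x)).2 - y₂ x)) (Icc α β) :=
    fun w hw => by
      have hu : ContinuousOn (fun x => (L (w x)).2) (Icc α β) :=
        (continuous_snd.comp L.continuous).comp_continuousOn fun x hx =>
          (hw x hx).2.continuousAt.continuousWithinAt
      exact (hu.sub h₁.continuousOn).mul (hu.sub h₂.continuousOn)
  have hin : ∀ p ∈ V, Reaches f₁ f₂ V p (L.symm (α, y₁ α)) := fun p hp => by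
    obtain ⟨w, hwp, hw⟩ := hw p hp
    have hx : (L p).1 ∈ Icc α β := hp.1
    -- The product of the height differences is nonpositive exactly between the graphs, zero on
    -- them, and a square at `β`, where the graphs meet. Its first zero is where the orbit hits the
    -- boundary.
    obtain ⟨r, hr, hr0, hle⟩ := exists_first_zero
      ((hcont w hw).mono (Icc_subset_Icc_left hx.1)) hx.2 (by simpa only [hwp] using hp.2)
      (by rw [hβ]; exact mul_self_nonneg _)
    have hr' : r ∈ Icc α β := ⟨hx.1.trans hr.1, hr.2⟩
    have h := hcurve w hw _ _ hx.1 hr.1 hr.2 hle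
    rw [hwp] at h
    rcases hbdry (w r) (by rw [(hw r hr').1]; exact hr0) with e | e
    · rw [e, (hw r hr').1] at h
      exact h.trans (hto₁ r hr')
    · rw [e, (hw r hr').1] at h
      exact h.trans (hto₂ r hr')
  have hout : ∀ p ∈ V, Reaches f₁ f₂ V (L.symm (α, y₁ α)) p := fun p hp => by
    obtain ⟨w, hwp, hw⟩ := hw p hp
    have hx : (L p).1 ∈ Icc α β := hp.1
    obtain ⟨r, hr, hr0, hle⟩ := exists_last_zero
      ((hcont w hw).mono (Icc_subset_Icc_right hx.2)) hx.1
      (by rw [hα]; exact mul_self_nonneg _) (by simpa only [hwp] using hp.2)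
    have hr' : r ∈ Icc α β := ⟨hr.1, hr.2.trans hx.2⟩
    have h := hcurve w hw _ _ hr.1 hr.2 hx.2 hle
    rw [hwp] at h
    rcases hbdry (w r) (by rw [(hw r hr').1]; exact hr0) with e | e
    · rw [e, (hw r hr').1] at h
      exact (hfrom₁ r hr').trans h
    · rw [e, (hw r hr').1] at h
      exact (hfrom₂ r hr').trans h
  exact fun a ha b hb => (hin a ha).trans (hout b hb)

end Transit

/-! ### Local flows and orbits as graphs -/

/-- The local flow of a `C¹` vector field, with values in a prescribed neighbourhood. -/
theorem exists_localFlow {g : Plane → Plane} {q : Plane} (hg : ContDiffAt ℝ 1 g q)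
    {N : Set Plane} (hN : N ∈ 𝓝 q) :
    ∃ N₀ ∈ 𝓝 q, ∃ ε > (0 : ℝ), ∃ Φ : Plane × ℝ → Plane,
      ContinuousOn Φ (N₀ ×ˢ Icc (-ε) ε) ∧ ∀ p ∈ N₀, Φ (p, 0) = p ∧
        ∀ t ∈ Icc (-ε) ε, Φ (p, t) ∈ N ∧ HasDerivAt (fun t => Φ (p, t)) (g (Φ (p, t))) t := by
  obtain ⟨ε, hε, a, r, K, C, hr, hpl⟩ := IsPicardLindelof.of_contDiffAt_one hg
  obtain ⟨Φ, hΦ, hc⟩ :=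
    (hpl 0).exists_forall_mem_closedBall_eq_hasDerivWithinAt_continuousOn
  simp only [zero_sub, zero_add] at hΦ hc
  have hΦq : Φ (q, 0) = q := (hΦ q (Metric.mem_closedBall_self r.2)).1
  have hnhds : Metric.closedBall q r ×ˢ Icc (-ε) ε ∈ 𝓝 (q, (0 : ℝ)) :=
    prod_mem_nhds (Metric.closedBall_mem_nhds q hr) (Icc_mem_nhds (by linarith) hε)
  have hat : ContinuousAt Φ (q, 0) := hc.continuousAt hnhds
  have hev : ∀ᶠ z in 𝓝 (q, (0 : ℝ)), Φ z ∈ N := hat (by rwa [hΦq])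
  rw [nhds_prod_eq] at hev
  obtain ⟨P, hP, Q, hQ, hPQ⟩ := eventually_prod_iff.1 hev
  obtain ⟨δ, hδ, hδQ⟩ := Metric.eventually_nhds_iff.1 hQ
  -- Halving `ε` keeps times in the open interval, where one-sided derivatives become two-sided.
  have hδ' : ∀ t ∈ Icc (-(min (ε / 2) (δ / 2))) (min (ε / 2) (δ / 2)), t ∈ Ioo (-ε) ε ∧ Q t := by
    intro t ht
    have h1 := min_le_left (ε / 2) (δ / 2)
    have h2 := min_le_right (ε / 2) (δ / 2)
    refine ⟨⟨by linarith [ht.1], by linarith [ht.2]⟩, hδQ ?_⟩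
    rw [Real.dist_eq, sub_zero, abs_lt]
    exact ⟨by linarith [ht.1], by linarith [ht.2]⟩
  refine ⟨Metric.closedBall q r ∩ {p | P p}, inter_mem (Metric.closedBall_mem_nhds q hr) hP,
    min (ε / 2) (δ / 2), by positivity, Φ, hc.mono fun z hz =>
      ⟨hz.1.1, Ioo_subset_Icc_self (hδ' _ hz.2).1⟩, fun p hp => ⟨(hΦ p hp.1).1, fun t ht => ?_⟩⟩
  obtain ⟨h1, h2⟩ := hδ' t ht
  exact ⟨hPQ hp.2 h2, ((hΦ p hp.1).2 t (Ioo_subset_Icc_self h1)).hasDerivAt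
    (Icc_mem_nhds h1.1 h1.2)⟩

theorem eq_add_of_hasDerivAt_one {h : ℝ → ℝ} {ε : ℝ}
    (hd : ∀ t ∈ Icc (-ε) ε, HasDerivAt h 1 t) {t : ℝ} (ht : t ∈ Icc (-ε) ε) : h t = h 0 + t := by
  have h0 : (0 : ℝ) ∈ Icc (-ε) ε := by
    have := ht.1.trans ht.2
    exact ⟨by linarith, by linarith⟩
  have := (convex_Icc (-ε) ε).norm_image_sub_le_of_norm_hasDerivWithin_le
    (f := fun t => h t - t) (f' := fun _ => 0) (C := 0)
    (fun r hr => by simpa using ((hd r hr).fun_sub (hasDerivAt_id' r)).hasDerivWithinAt)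
    (fun r _ => by simp) h0 ht
  simp only [sub_zero, zero_mul, norm_le_zero_iff] at this
  linarith

theorem eventually_pos_of_hasDerivAt {h : ℝ → ℝ} {D : ℝ} (hd : HasDerivAt h D 0) (h0 : h 0 = 0)
    (hD : 0 < D) : ∀ᶠ t in 𝓝[>] (0 : ℝ), 0 < h t := by
  have h1 := (hasDerivAt_iff_tendsto_slope.1 hd).mono_left
    (nhdsWithin_mono 0 fun t (ht : 0 < t) => ht.ne')
  filter_upwards [h1.eventually (lt_mem_nhds hD), self_mem_nhdsWithin] with t ht ht0
  rw [slope_def_field, h0, sub_zero, sub_zero] at ht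
  exact (div_pos_iff_of_pos_right ht0).1 ht

/-- The vector field `f` rescaled to unit speed in the first coordinate of `L`. -/
noncomputable def unitSpeed (L : Plane ≃L[ℝ] ℝ × ℝ) (f : Plane → Plane) (p : Plane) : Plane :=
  (L (f p)).1⁻¹ • f p

section UnitSpeed

variable {L : Plane ≃L[ℝ] ℝ × ℝ} {f : Plane → Plane} {p q : Plane}

theorem contDiffAt_unitSpeed (hf : ContDiff ℝ 1 f) (hq : (L (f q)).1 ≠ 0) :
    ContDiffAt ℝ 1 (unitSpeed L f) q := by
  have h : ContDiffAt ℝ 1 (fun p => (L (f p)).1) q :=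
    (contDiff_fst.comp (L.contDiff.comp hf)).contDiffAt
  exact (h.inv hq).smul hf.contDiffAt

theorem fst_unitSpeed (hp : (L (f p)).1 ≠ 0) : (L (unitSpeed L f p)).1 = 1 := by
  simp [unitSpeed, hp]

theorem snd_unitSpeed : (L (unitSpeed L f p)).2 = (L (f p)).2 / (L (f p)).1 := by
  simp [unitSpeed, div_eq_inv_mul]

theorem fst_integralCurve {u : ℝ → Plane} {ε : ℝ}
    (hu : ∀ t ∈ Icc (-ε) ε, (L (f (u t))).1 ≠ 0 ∧ HasDerivAt u (unitSpeed L f (u t)) t)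
    {t : ℝ} (ht : t ∈ Icc (-ε) ε) : (L (u t)).1 = (L (u 0)).1 + t := by
  refine eq_add_of_hasDerivAt_one (h := fun t => (L (u t)).1) (fun r hr => ?_) ht
  have h1 := ((ContinuousLinearMap.fst ℝ ℝ ℝ).comp
    (L : Plane →L[ℝ] ℝ × ℝ)).hasFDerivAt.comp_hasDerivAt r (hu r hr).2
  have h2 := fst_unitSpeed (hu r hr).1
  simpa [h2, Function.comp_def] using h1

theorem hasDerivAt_snd {u : ℝ → Plane} {t : ℝ} (hu : HasDerivAt u (unitSpeed L f (u t)) t) :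
    HasDerivAt (fun t => (L (u t)).2) ((L (f (u t))).2 / (L (f (u t))).1) t := by
  have h1 := ((ContinuousLinearMap.snd ℝ ℝ ℝ).comp
    (L : Plane →L[ℝ] ℝ × ℝ)).hasFDerivAt.comp_hasDerivAt t hu
  have h2 := snd_unitSpeed (L := L) (f := f) (p := u t)
  simpa [h2, Function.comp_def] using h1

/-- An integral curve of the rescaled field is a graph over the first coordinate. -/
theorem exists_graph_of_integralCurve {u : ℝ → Plane} {ε τ α : ℝ} (hτ : 0 ≤ τ) (hτε : τ ≤ ε)
    (hα : (L (u 0)).1 = α)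
    (hu : ∀ t ∈ Icc (-ε) ε, (L (f (u t))).1 ≠ 0 ∧ HasDerivAt u (unitSpeed L f (u t)) t) :
    ∃ y : ℝ → ℝ, Continuous y ∧ (∀ x ∈ Icc α (α + τ), L.symm (x, y x) = u (x - α)) ∧
      ∀ x ∈ Ioo α (α + τ), HasDerivAt (fun x => L.symm (x, y x))
        (unitSpeed L f (L.symm (x, y x))) x := by
  -- Clamping the time to `[0, τ]` makes the height function continuous on all of `ℝ`.
  set c : ℝ → ℝ := fun x => max 0 (min (x - α) τ) with hc
  have hcmem : ∀ x, c x ∈ Icc (-ε) ε := fun x =>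
    ⟨by linarith [le_max_left 0 (min (x - α) τ)],
      (max_le hτ (min_le_right _ _)).trans hτε⟩
  have hcid : ∀ x ∈ Icc α (α + τ), c x = x - α := fun x hx => by
    rw [hc]
    simp only
    rw [min_eq_left (by linarith [hx.2]), max_eq_right (by linarith [hx.1])]
  have hgraph : ∀ x ∈ Icc α (α + τ), L.symm (x, (L (u (c x))).2) = u (x - α) := fun x hx => by
    have h1 := fst_integralCurve hu (hcmem x)
    rw [hcid x hx, hα, add_sub_cancel] at h1
    rw [hcid x hx, L.symm_apply_eq]
    exact Prod.ext h1.symm rfl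
  have huc : ContinuousOn u (Icc (-ε) ε) := fun t ht =>
    (hu t ht).2.continuousAt.continuousWithinAt
  refine ⟨fun x => (L (u (c x))).2, continuous_snd.comp (L.continuous.comp
    (huc.comp_continuous (by fun_prop) hcmem)), hgraph, fun x hx => ?_⟩
  rw [hgraph x (Ioo_subset_Icc_self hx)]
  have hmem : x - α ∈ Icc (-ε) ε := hcid x (Ioo_subset_Icc_self hx) ▸ hcmem x
  refine ((hu _ hmem).2.comp_sub_const x α).congr_of_eventuallyEq ?_
  filter_upwards [isOpen_Ioo.mem_nhds hx] with r hr
  exact hgraph r (Ioo_subset_Icc_self hr)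

end UnitSpeed

/-! ### Two orbits that meet twice -/

section Switching

variable {f₁ f₂ : Plane → Plane} {L : Plane ≃L[ℝ] ℝ × ℝ} {q : Plane}

/-- Near a point where the first coordinates of the two branches have opposite signs and the
orientation of the pair of branches is not locally constant, an orbit of the first branch meets an
orbit of the second one twice. -/
theorem exists_regionBetweenGraphs (hf₁ : ContDiff ℝ 1 f₁) (hf₂ : ContDiff ℝ 1 f₂)
    (hneg : (L (f₁ q)).1 < 0) (hpos : 0 < (L (f₂ q)).1)
    (hsign : ∀ W ∈ 𝓝 q,
      (∃ p ∈ W, 0 < (L (f₁ p)).1 * (L (f₂ p)).2 - (L (f₁ p)).2 * (L (f₂ p)).1) ∧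
      ∃ p ∈ W, (L (f₁ p)).1 * (L (f₂ p)).2 - (L (f₁ p)).2 * (L (f₂ p)).1 < 0)
    {U : Set Plane} (hU : U ∈ 𝓝 q) :
    ∃ (α β : ℝ) (y₁ y₂ : ℝ → ℝ), α < β ∧ Continuous y₁ ∧ Continuous y₂ ∧
      L ⁻¹' regionBetweenGraphs α β y₁ y₂ ⊆ U ∧
      ∀ a ∈ L ⁻¹' regionBetweenGraphs α β y₁ y₂, ∀ b ∈ L ⁻¹' regionBetweenGraphs α β y₁ y₂,
        Reaches f₁ f₂ (L ⁻¹' regionBetweenGraphs α β y₁ y₂) a b := by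
  have hX₁ : Continuous fun p => (L (f₁ p)).1 :=
    continuous_fst.comp (L.continuous.comp hf₁.continuous)
  have hX₂ : Continuous fun p => (L (f₂ p)).1 :=
    continuous_fst.comp (L.continuous.comp hf₂.continuous)
  set N : Set Plane := U ∩ {p | (L (f₁ p)).1 < 0 ∧ 0 < (L (f₂ p)).1} with hNdef
  have hN : N ∈ 𝓝 q := inter_mem hU
    (inter_mem ((isOpen_lt hX₁ continuous_const).mem_nhds hneg)
      ((isOpen_lt continuous_const hX₂).mem_nhds hpos))
  have hg₁ := contDiffAt_unitSpeed (L := L) hf₁ hneg.ne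
  have hg₂ := contDiffAt_unitSpeed (L := L) hf₂ hpos.ne'
  -- The flow `Ψ` is fixed before the box and the flows `Φ₁`, `Φ₂` into it: the region will lie in
  -- the box, so each of its points has a `Ψ`-orbit of length `ε₀` on which the signs of the first
  -- coordinates hold.
  obtain ⟨N₀, hN₀, ε₀, hε₀, Ψ, -, hΨ⟩ := exists_localFlow hg₂ hN
  obtain ⟨ρ, hρ, hbox⟩ : ∃ ρ > 0, L ⁻¹' Metric.ball (L q) ρ ⊆ N ∩ N₀ := by
    have h : L.symm ⁻¹' (N ∩ N₀) ∈ 𝓝 (L q) :=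
      L.symm.continuous.continuousAt (by
        rw [L.symm_apply_apply]; exact inter_mem hN hN₀)
    obtain ⟨ρ, hρ, hsub⟩ := Metric.mem_nhds_iff.1 h
    exact ⟨ρ, hρ, fun z hz => by simpa using hsub hz⟩
  have hboxq : L ⁻¹' Metric.ball (L q) ρ ∈ 𝓝 q :=
    L.continuous.continuousAt (Metric.ball_mem_nhds _ hρ)
  obtain ⟨N₁, hN₁, ε₁, hε₁, Φ₁, hΦc₁, hΦ₁⟩ := exists_localFlow hg₁ hboxq
  obtain ⟨N₂, hN₂, ε₂, hε₂, Φ₂, hΦc₂, hΦ₂⟩ := exists_localFlow hg₂ hboxq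
  obtain ⟨δ, hδ, hball⟩ := Metric.mem_nhds_iff.1 (inter_mem hN₁ hN₂)
  obtain ⟨⟨p', hp', hd'⟩, p'', hp'', hd''⟩ := hsign _ (Metric.ball_mem_nhds q hδ)
  have hmemN : ∀ p ∈ N₁, p ∈ N := fun p hp => by
    have := ((hΦ₁ p hp).2 0 ⟨by linarith, hε₁.le⟩).1
    rw [(hΦ₁ p hp).1] at this
    exact (hbox this).1
  -- The difference of the slopes of the two orbits is the determinant divided by minus the product
  -- of the first coordinates, a positive denominator.
  have hslope : ∀ p ∈ Metric.ball q δ, HasDerivAt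
      (fun t => (L (Φ₁ (p, t))).2 - (L (Φ₂ (p, t))).2)
      (((L (f₁ p)).1 * (L (f₂ p)).2 - (L (f₁ p)).2 * (L (f₂ p)).1) /
        (-((L (f₁ p)).1 * (L (f₂ p)).1))) 0 := fun p hp => by
    obtain ⟨hp1, hp2⟩ := hball hp
    have h1 := hasDerivAt_snd (L := L) (f := f₁) (u := fun t => Φ₁ (p, t)) (t := 0)
      ((hΦ₁ p hp1).2 0 ⟨by linarith, hε₁.le⟩).2
    have h2 := hasDerivAt_snd (L := L) (f := f₂) (u := fun t => Φ₂ (p, t)) (t := 0)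
      ((hΦ₂ p hp2).2 0 ⟨by linarith, hε₂.le⟩).2
    simp only [(hΦ₁ p hp1).1, (hΦ₂ p hp2).1] at h1 h2
    convert! h1.sub h2 using 1
    have hne1 := (hmemN p hp1).2.1.ne
    have hne2 := (hmemN p hp1).2.2.ne'
    field_simp
    ring
  have hzero : ∀ p ∈ Metric.ball q δ, (L (Φ₁ (p, 0))).2 - (L (Φ₂ (p, 0))).2 = 0 := fun p hp => by
    rw [(hΦ₁ p (hball hp).1).1, (hΦ₂ p (hball hp).2).1, sub_self]
  have hden : ∀ p ∈ Metric.ball q δ, 0 < -((L (f₁ p)).1 * (L (f₂ p)).1) := fun p hp =>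
    neg_pos.2 (mul_neg_of_neg_of_pos (hmemN p (hball hp).1).2.1 (hmemN p (hball hp).1).2.2)
  have hev' := eventually_pos_of_hasDerivAt (hslope p' hp') (hzero p' hp')
    (div_pos hd' (hden p' hp'))
  have hev'' := eventually_pos_of_hasDerivAt (hslope p'' hp'').neg 
    (by rw [Pi.neg_apply, hzero p'' hp'', neg_zero])
    (neg_pos.2 (div_neg_of_neg_of_pos hd'' (hden p'' hp'')))
  obtain ⟨τ, ⟨⟨hτ', hτ''⟩, hτ1⟩, hτ0⟩ :=
    (((hev'.and hev'').and (mem_nhdsWithin_of_mem_nhds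
      (Iio_mem_nhds (show 0 < min ε₀ (min ε₁ ε₂) by positivity)))).and
        self_mem_nhdsWithin).exists
  replace hτ0 : 0 < τ := hτ0
  have hτε₀ : τ ≤ ε₀ := (lt_min_iff.1 hτ1).1.le
  have hτε₁ : τ ≤ ε₁ := (lt_min_iff.1 (lt_min_iff.1 hτ1).2).1.le
  have hτε₂ : τ ≤ ε₂ := (lt_min_iff.1 (lt_min_iff.1 hτ1).2).2.le
  obtain ⟨p, hp, hpF⟩ : ∃ p ∈ Metric.ball q δ,
      (L (Φ₁ (p, τ))).2 - (L (Φ₂ (p, τ))).2 = 0 := by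
    have hc : ContinuousOn (fun p => (L (Φ₁ (p, τ))).2 - (L (Φ₂ (p, τ))).2)
        (Metric.ball q δ) := by
      have h1 : ContinuousOn (fun p => Φ₁ (p, τ)) (Metric.ball q δ) :=
        hΦc₁.comp (by fun_prop) fun p hp => ⟨(hball hp).1, by linarith, hτε₁⟩
      have h2 : ContinuousOn (fun p => Φ₂ (p, τ)) (Metric.ball q δ) :=
        hΦc₂.comp (by fun_prop) fun p hp => ⟨(hball hp).2, by linarith, hτε₂⟩
      have hY : Continuous fun z => (L z).2 := continuous_snd.comp L.continuous
      exact (hY.comp_continuousOn h1).sub (hY.comp_continuousOn h2)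
    exact (convex_ball q δ).isPreconnected.intermediate_value hp'' hp' hc
      ⟨(neg_pos.1 hτ'').le, hτ'.le⟩
  obtain ⟨hp1, hp2⟩ := hball hp
  have hcurve₁ : ∀ t ∈ Icc (-ε₁) ε₁, (L (f₁ (Φ₁ (p, t)))).1 ≠ 0 ∧
      HasDerivAt (fun t => Φ₁ (p, t)) (unitSpeed L f₁ (Φ₁ (p, t))) t := fun t ht =>
    ⟨(hbox ((hΦ₁ p hp1).2 t ht).1).1.2.1.ne, ((hΦ₁ p hp1).2 t ht).2⟩
  have hcurve₂ : ∀ t ∈ Icc (-ε₂) ε₂, (L (f₂ (Φ₂ (p, t)))).1 ≠ 0 ∧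
      HasDerivAt (fun t => Φ₂ (p, t)) (unitSpeed L f₂ (Φ₂ (p, t))) t := fun t ht =>
    ⟨(hbox ((hΦ₂ p hp2).2 t ht).1).1.2.2.ne', ((hΦ₂ p hp2).2 t ht).2⟩
  set α := (L p).1 with hα
  obtain ⟨y₁, hy₁, hgr₁, hdy₁⟩ := exists_graph_of_integralCurve (α := α) hτ0.le hτε₁
    (by rw [(hΦ₁ p hp1).1]) hcurve₁
  obtain ⟨y₂, hy₂, hgr₂, hdy₂⟩ := exists_graph_of_integralCurve (α := α) hτ0.le hτε₂
    (by rw [(hΦ₂ p hp2).1]) hcurve₂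
  have hsnd₁ : ∀ x ∈ Icc α (α + τ), y₁ x = (L (Φ₁ (p, x - α))).2 := fun x hx => by
    rw [← hgr₁ x hx, L.apply_symm_apply]
  have hsnd₂ : ∀ x ∈ Icc α (α + τ), y₂ x = (L (Φ₂ (p, x - α))).2 := fun x hx => by
    rw [← hgr₂ x hx, L.apply_symm_apply]
  have hl : α ∈ Icc α (α + τ) := ⟨le_rfl, by linarith⟩
  have hr : α + τ ∈ Icc α (α + τ) := ⟨by linarith, le_rfl⟩
  -- A ball of `ℝ × ℝ` is a square, so it contains every point lying vertically between two of its
  -- points.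
  have hVbox : L ⁻¹' regionBetweenGraphs α (α + τ) y₁ y₂ ⊆ L ⁻¹' Metric.ball (L q) ρ := by
    rintro z ⟨hz1, hz2⟩
    have h1 : L (L.symm ((L z).1, y₁ (L z).1)) ∈ Metric.ball (L q) ρ := by
      rw [hgr₁ _ hz1]
      exact ((hΦ₁ p hp1).2 _ ⟨by linarith [hz1.1], by linarith [hz1.2]⟩).1
    have h2 : L (L.symm ((L z).1, y₂ (L z).1)) ∈ Metric.ball (L q) ρ := by
      rw [hgr₂ _ hz1]
      exact ((hΦ₂ p hp2).2 _ ⟨by linarith [hz1.1], by linarith [hz1.2]⟩).1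
    rw [L.apply_symm_apply, Metric.mem_ball, Prod.dist_eq, max_lt_iff, Real.dist_eq, Real.dist_eq,
      abs_lt, abs_lt] at h1 h2
    rw [mem_preimage, Metric.mem_ball, Prod.dist_eq, max_lt_iff, Real.dist_eq, Real.dist_eq,
      abs_lt, abs_lt]
    simp only at h1 h2
    refine ⟨h1.1, ?_⟩
    rcases mul_nonpos_iff.1 hz2 with ⟨h3, h4⟩ | ⟨h3, h4⟩
    · exact ⟨by linarith, by linarith⟩
    · exact ⟨by linarith, by linarith⟩
  refine ⟨α, α + τ, y₁, y₂, by linarith, hy₁, hy₂, fun z hz => (hbox (hVbox hz)).1.1,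
    reaches_of_regionBetweenGraphs hf₁.continuous hf₂.continuous (by linarith) hy₁ hy₂ ?_ ?_
      (fun z hz => (hbox (hVbox hz)).1.2.1) (fun z hz => (hbox (hVbox hz)).1.2.2) hdy₁ hdy₂
      fun z hz => ?_⟩
  · rw [hsnd₁ α hl, hsnd₂ α hl, sub_self, (hΦ₁ p hp1).1, (hΦ₂ p hp2).1]
  · rw [hsnd₁ _ hr, hsnd₂ _ hr, add_sub_cancel_left]
    exact sub_eq_zero.1 hpF
  · have hzΨ := hΨ z (hbox (hVbox hz)).2
    refine ⟨fun x => Ψ (z, x - (L z).1), by simp [hzΨ.1], fun x hx => ?_⟩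
    have hz1 : (L z).1 ∈ Icc α (α + τ) := hz.1
    have hmem : x - (L z).1 ∈ Icc (-ε₀) ε₀ :=
      ⟨by linarith [hz1.2, hx.1], by linarith [hz1.1, hx.2]⟩
    refine ⟨?_, (hzΨ.2 _ hmem).2.comp_sub_const x _⟩
    have := fst_integralCurve (L := L) (f := f₂) (u := fun t => Ψ (z, t)) (ε := ε₀)
      (fun t ht => ⟨(hzΨ.2 t ht).1.2.2.ne', (hzΨ.2 t ht).2⟩) hmem
    simp only [hzΨ.1] at this
    rw [this]
    ring

end Switching

/-! ### The hyperbolic fixed point -/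

/-- Linear coordinates of the plane in which a given non-zero vector is the first basis vector. -/
theorem exists_coordinates {c : Plane} (hc : c ≠ 0) : ∃ L : Plane ≃L[ℝ] ℝ × ℝ, L c = (1, 0) := by
  have hn : c 0 ^ 2 + c 1 ^ 2 ≠ 0 := fun h => hc (by
    have h0 : c 0 = 0 := by nlinarith [sq_nonneg (c 0), sq_nonneg (c 1)]
    have h1 : c 1 = 0 := by nlinarith [sq_nonneg (c 0), sq_nonneg (c 1)]
    ext i
    fin_cases i
    · exact h0
    · exact h1)
  let e : Plane ≃ₗ[ℝ] ℝ × ℝ :=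
    -- With the plane read as `ℂ`, this is division by `c`, and the inverse is multiplication by
    -- `c`.
    { toFun := fun z => ((c 0 * z 0 + c 1 * z 1) / (c 0 ^ 2 + c 1 ^ 2),
        (c 0 * z 1 - c 1 * z 0) / (c 0 ^ 2 + c 1 ^ 2))
      invFun := fun w => !₂[c 0 * w.1 - c 1 * w.2, c 1 * w.1 + c 0 * w.2]
      map_add' := fun x y => by
        ext
        · simp only [PiLp.add_apply, Prod.fst_add]; ring
        · simp only [PiLp.add_apply, Prod.snd_add]; ring
      map_smul' := fun r x => by
        ext
        · simp only [PiLp.smul_apply, Prod.smul_fst, smul_eq_mul, RingHom.id_apply]; ring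
        · simp only [PiLp.smul_apply, Prod.smul_snd, smul_eq_mul, RingHom.id_apply]; ring
      left_inv := fun z => by
        ext i
        fin_cases i
        · simp; field_simp; ring
        · simp; field_simp; ring
      right_inv := fun w => by
        ext
        · simp; field_simp; ring
        · simp; field_simp; ring }
  refine ⟨e.toContinuousLinearEquiv, ?_⟩
  change ((c 0 * c 0 + c 1 * c 1) / (c 0 ^ 2 + c 1 ^ 2),
    (c 0 * c 1 - c 1 * c 0) / (c 0 ^ 2 + c 1 ^ 2)) = ((1, 0) : ℝ × ℝ)
  ext
  · field_simp
  · simp only; ring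

/-- A vanishing determinant would make `0` an eigenvalue, with real part zero. -/
theorem IsHyperbolicFixedPoint.det_ne_zero {f : Plane → Plane} {a : Plane}
    (h : IsHyperbolicFixedPoint f a) :
    LinearMap.det (fderiv ℝ f a : Plane →ₗ[ℝ] Plane) ≠ 0 := fun hdet => by
  refine h.2 0 ?_ Complex.zero_re
  rw [LinearMap.det_eq_sign_charpoly_coeff, mul_eq_zero] at hdet
  have h0 : (LinearMap.charpoly (fderiv ℝ f a : Plane →ₗ[ℝ] Plane)).coeff 0 = 0 :=
    hdet.resolve_left (pow_ne_zero _ (by norm_num))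
  rw [← Polynomial.coeff_zero_eq_aeval_zero', h0, map_zero]

/-- Near a hyperbolic fixed point of `f₁` at which `f₂` does not vanish, there are points at which
the branches point in opposite directions and change their relative orientation. -/
theorem exists_opposite_branches {f₁ f₂ : Plane → Plane} (hf₁ : ContDiff ℝ 1 f₁)
    (hf₂ : ContDiff ℝ 1 f₂) {a : Plane} (ha : IsHyperbolicFixedPoint f₁ a)
    {L : Plane ≃L[ℝ] ℝ × ℝ} (hL : L (f₂ a) = (1, 0)) {U : Set Plane} (hU : U ∈ 𝓝 a) :
    ∃ q, U ∈ 𝓝 q ∧ (L (f₁ q)).1 < 0 ∧ 0 < (L (f₂ q)).1 ∧ ∀ W ∈ 𝓝 q,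
      (∃ p ∈ W, 0 < (L (f₁ p)).1 * (L (f₂ p)).2 - (L (f₁ p)).2 * (L (f₂ p)).1) ∧
      ∃ p ∈ W, (L (f₁ p)).1 * (L (f₂ p)).2 - (L (f₁ p)).2 * (L (f₂ p)).1 < 0 := by
  set G : Plane → ℝ × ℝ := fun p =>
    ((L (f₁ p)).1, (L (f₁ p)).1 * (L (f₂ p)).2 - (L (f₁ p)).2 * (L (f₂ p)).1) with hG
  have hfst : ∀ f : Plane → Plane, ContDiff ℝ 1 f → ContDiff ℝ 1 fun p => (L (f p)).1 :=
    fun f hf => contDiff_fst.comp (L.contDiff.comp hf)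
  have hsnd : ∀ f : Plane → Plane, ContDiff ℝ 1 f → ContDiff ℝ 1 fun p => (L (f p)).2 :=
    fun f hf => contDiff_snd.comp (L.contDiff.comp hf)
  have hGc : ContDiff ℝ 1 G := (hfst f₁ hf₁).prodMk
    (((hfst f₁ hf₁).mul (hsnd f₂ hf₂)).sub ((hsnd f₁ hf₁).mul (hfst f₂ hf₂)))
  let A : Plane ≃L[ℝ] Plane :=
    (LinearEquiv.ofIsUnitDet (f := (fderiv ℝ f₁ a : Plane →ₗ[ℝ] Plane))
      (v := Module.finBasis ℝ Plane) (v' := Module.finBasis ℝ Plane) (by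
        rw [LinearMap.det_toMatrix]
        exact isUnit_iff_ne_zero.2 ha.det_ne_zero)).toContinuousLinearEquiv
  have hA : ∀ h, A h = fderiv ℝ f₁ a h := fun h => rfl
  -- As `f₁ a = 0` and `L (f₂ a) = (1, 0)`, only the term with the second coordinate of `f₁`
  -- survives in the derivative of the determinant, with a minus sign.
  let G' : Plane ≃L[ℝ] ℝ × ℝ := (A.trans L).trans
    ((ContinuousLinearEquiv.refl ℝ ℝ).prodCongr (ContinuousLinearEquiv.neg ℝ))
  have hfd : ∀ f : Plane → Plane, ContDiff ℝ 1 f → HasFDerivAt (fun p => L (f p))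
      ((L : Plane →L[ℝ] ℝ × ℝ).comp (fderiv ℝ f a)) a := fun f hf =>
    L.hasFDerivAt.comp a ((hf.differentiable one_ne_zero) a).hasFDerivAt
  have hGd : HasFDerivAt G (G' : Plane →L[ℝ] ℝ × ℝ) a := by
    have h1 := hfd f₁ hf₁
    have h2 := hfd f₂ hf₂
    have h := h1.fst.prodMk ((h1.fst.mul h2.snd).sub (h1.snd.mul h2.fst))
    convert! h using 1
    ext v
    · simp [G', hA]
    · simp [G', hA, ha.1, hL]
  have hGa : G a = (0, 0) := by simp [hG, ha.1]
  set e := hGc.contDiffAt.toOpenPartialHomeomorph G hGd one_ne_zero with he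
  have hcoe : (e : Plane → ℝ × ℝ) = G := rfl
  have hsrc : a ∈ e.source :=
    ContDiffAt.mem_toOpenPartialHomeomorph_source hGc.contDiffAt hGd one_ne_zero
  have hopen : ∀ p ∈ e.source, ∀ W ∈ 𝓝 p, G '' W ∈ 𝓝 (G p) := fun p hp W hW => by
    rw [← hcoe, ← e.map_nhds_eq hp]
    exact image_mem_map hW
  have hN : e.source ∩ (interior U ∩ {p | 0 < (L (f₂ p)).1}) ∈ 𝓝 a :=
    inter_mem (e.open_source.mem_nhds hsrc) (inter_mem (interior_mem_nhds.2 hU)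
      ((isOpen_lt continuous_const (hfst f₂ hf₂).continuous).mem_nhds (by simp [hL])))
  -- The image of a neighbourhood of `a` contains some `(s, 0)` with `s < 0`: determinant zero,
  -- first coordinate negative. Openness of `G` at its preimage `q` then yields both signs of the
  -- determinant.
  obtain ⟨s, ⟨q, ⟨hqs, hqU, hq2⟩, hqG⟩, hs⟩ :
      ∃ s : ℝ, (s, (0 : ℝ)) ∈ G '' (e.source ∩ (interior U ∩ {p | 0 < (L (f₂ p)).1})) ∧ s < 0 := by
    have ht : Tendsto (fun s : ℝ => (s, (0 : ℝ))) (𝓝[<] 0) (𝓝 (G a)) := by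
      rw [hGa]
      exact ((Continuous.prodMk_left (0 : ℝ)).tendsto 0).mono_left nhdsWithin_le_nhds
    exact ((ht.eventually (hopen a hsrc _ hN)).and self_mem_nhdsWithin).exists
  have hq1 : (L (f₁ q)).1 = s := congrArg Prod.fst hqG
  have ht : Tendsto (fun r : ℝ => (s, r)) (𝓝 0) (𝓝 (G q)) := by
    rw [hqG]
    exact (Continuous.prodMk_right s).tendsto 0
  refine ⟨q, mem_interior_iff_mem_nhds.1 hqU, hq1 ▸ hs, hq2, fun W hW => ⟨?_, ?_⟩⟩
  · obtain ⟨r, ⟨p, hp, hpG⟩, hr⟩ := (((ht.mono_left nhdsWithin_le_nhds).eventually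
      (hopen q hqs W hW)).and (self_mem_nhdsWithin (s := Ioi (0 : ℝ)))).exists
    exact ⟨p, hp, (congrArg Prod.snd hpG).trans_gt hr⟩
  · obtain ⟨r, ⟨p, hp, hpG⟩, hr⟩ := (((ht.mono_left nhdsWithin_le_nhds).eventually
      (hopen q hqs W hW)).and (self_mem_nhdsWithin (s := Iio (0 : ℝ)))).exists
    exact ⟨p, hp, (congrArg Prod.snd hpG).trans_lt hr⟩

theorem theorem3 (f₁ f₂ : Plane → Plane) (hf₁ : ContDiff ℝ 1 f₁) (hf₂ : ContDiff ℝ 1 f₂)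
    (K : Set Plane) (hK : IsCompact K) (hKf₂ : NoBoundedSolutionsIn f₂ K)
    (a : Plane) (haK : a ∈ K) (ha : IsHyperbolicFixedPoint f₁ a)
    (U : Set Plane) (hU : U ∈ 𝓝 a) :
    ∃ V : Set Plane, V ⊆ U ∧ V.Nonempty ∧ IsCompact V ∧
      IsConnected Vᶜ ∧ ¬ Bornology.IsBounded Vᶜ ∧
      RS1 (solutionSet f₁ f₂) V ∧ BV3 (solutionSet f₁ f₂) V := by
  have hc : f₂ a ≠ 0 := fun h => hKf₂ ⟨fun _ => a, fun t => ⟨by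
    rw [h]; exact hasDerivAt_const t a, haK⟩⟩
  obtain ⟨L, hL⟩ := exists_coordinates hc
  obtain ⟨q, hqU, hq1, hq2, hsign⟩ := exists_opposite_branches hf₁ hf₂ ha hL hU
  obtain ⟨α, β, y₁, y₂, hαβ, hy₁, hy₂, hVU, hreach⟩ :=
    exists_regionBetweenGraphs hf₁ hf₂ hq1 hq2 hsign hqU
  set V := L ⁻¹' regionBetweenGraphs α β y₁ y₂ with hVdef
  have hVc : IsCompact V :=
    L.toHomeomorph.isCompact_preimage.2 (isCompact_regionBetweenGraphs hy₁ hy₂)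
  have hmem : ∀ x ∈ Icc α β, L.symm (x, y₁ x) ∈ V := fun x hx => by
    simp [hVdef, regionBetweenGraphs, hx.1, hx.2]
  -- The region may degenerate to a single arc; `α < β` still gives two points.
  have hVn : V.Nontrivial := ⟨_, hmem α ⟨le_rfl, hαβ.le⟩, _, hmem β ⟨hαβ.le, le_rfl⟩, fun h =>
    hαβ.ne (congrArg Prod.fst (L.symm.injective h))⟩
  obtain ⟨M₁, hM₁⟩ := hVc.exists_bound_of_continuousOn hf₁.continuous.continuousOn
  obtain ⟨M₂, hM₂⟩ := hVc.exists_bound_of_continuousOn hf₂.continuous.continuousOn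
  have hM : ∀ z ∈ V, ‖f₁ z‖ ≤ (max M₁ M₂).toNNReal ∧ ‖f₂ z‖ ≤ (max M₁ M₂).toNNReal :=
    fun z hz => ⟨(hM₁ z hz).trans ((le_max_left _ _).trans (Real.le_coe_toNNReal _)),
      (hM₂ z hz).trans ((le_max_right _ _).trans (Real.le_coe_toNNReal _))⟩
  refine ⟨V, hVU, hVn.nonempty, hVc, ?_, fun hb => ?_,
    rs1_of_reaches hf₁.continuous hf₂.continuous hM hVn hreach, bv3_of_reaches hVc hM hVn hreach⟩
  · exact L.toHomeomorph.isConnected_preimage.2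
      (isPathConnected_compl_regionBetweenGraphs hy₁ hy₂).isConnected
  · refine NormedSpace.unbounded_univ ℝ Plane ?_
    rw [← union_compl_self V]
    exact hVc.isBounded.union hb
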